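/- Let $d\ge 1$ and let $\Omega\subseteq\mathbb{R}^d$ be a bounded open set with $\Omega=\operatorname{int}\overline{\Omega}$ (for instance a bounded polyhedral Lipschitz domain) whose closure is the union of the elements of a finite conforming triangulation $\mathcal{T}_h$ consisting of closed non-degenerate $d$-simplices. Let $\mathcal{S}_h^{i}$ be the set of interior sides (common $(d-1)$-dimensional faces of two elements) and $\mathcal{S}_h^{\partial}$ the set of boundary sides ($(d-1)$-dimensional faces of elements that are contained in $\partial\Omega$). Let $\Gamma_I\neq\emptyset$, $\Gamma_D$, $\Gamma_N\subseteq\partial\Omega$ be disjoint and relatively open with $\partial\Omega=\overline{\Gamma}_I\cup\overline{\Gamma}_D\cup\overline{\Gamma}_N$, put $\mathcal{S}_h^{X}=\{S\in\mathcal{S}_h^\partial: \operatorname{relint} S\subseteq\Gamma_X\}$ for $X\in\{I,D,N\}$, and assume $\mathcal{S}_h^\partial=\mathcal{S}_h^I\cup\mathcal{S}_h^D\cup\mathcal{S}_h^N$. Let $\mathcal{L}^k(\mathcal{T}_h)$ be the space of element-wise polynomial functions of degree at most $k$ and $\mathcal{L}^0(\mathcal{S}_h^X)$ the space of functions that are constant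 on each $S\in\mathcal{S}_h^X$. Let $\nabla_h$ be the element-wise gradient, $\Pi_h$ the average over each element and $\pi_h$ the average over each side. Let $$\mathcal{S}^{1,cr}(\mathcal{T}_h)=\{v_h\in\mathcal{L}^1(\mathcal{T}_h): \text{the jump of } v_h \text{ has average } 0 \text{ on every } S\in\mathcal{S}_h^i\}$$ be the Crouzeix--Raviart space, and let $\mathcal{R}T^0(\mathcal{T}_h)$ be the Raviart--Thomas space of all $y_h\in(\mathcal{L}^1(\mathcal{T}_h))^d$ whose normal component is constant on each side of each element and whose normal jump vanishes on every $S\in\mathcal{S}_h^i$. On $\partial\Omega$, let $n$ be the outward unit normal. Norms and inner products on subsets of $\partial\Omega$ are taken with respect to the surface measure. Let $m>0$, $f_h\in\mathcal{L}^0(\mathcal{T}_h)$, $g_h\in\mathcal{L}^0(\mathcal{S}_h^N)$, $u_D^h\in\mathcal{L}^0(\mathcal{S}_h^D)$. For $v_h\in\mathcal{S}^{1,cr}(\mathcal{T}_h)$ let $$I_h^{cr}(v_h)=\tfrac12\|\nabla_h v_h\|_{L^2(\Omega)}^2+\tfrac1{2m}\|\pi_h v_h\|_{L^1(\Gamma_I)}^2-(f_h,\Pi_h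 v_h)_\Omega-(g_h,\pi_h v_h)_{\Gamma_N}$$ if $\pi_h v_h=u_D^h$ on $\Gamma_D$, and $I_h^{cr}(v_h)=+\infty$ otherwise. For $y_h\in\mathcal{R}T^0(\mathcal{T}_h)$ let $$D_h^{rt}(y_h)=-\tfrac12\|\Pi_h y_h\|_{L^2(\Omega)}^2-\tfrac m2\|y_h\cdot n\|_{L^\infty(\Gamma_I)}^2+(y_h\cdot n,u_D^h)_{\Gamma_D}$$ if $\operatorname{div}y_h=-f_h$ in $\Omega$ and $y_h\cdot n=g_h$ on $\Gamma_N$, and $D_h^{rt}(y_h)=-\infty$ otherwise. Let $K_h^{cr}=\operatorname{dom}(I_h^{cr})$ and $K_h^{rt,*}=\operatorname{dom}(-D_h^{rt})$ be the effective domains. Let $v_h\in K_h^{cr}$ and $y_h\in K_h^{rt,*}$. Then $I_h^{cr}$ has a minimizer $u_h^{cr}\in K_h^{cr}$ and $D_h^{rt}$ has a unique maximizer $z_h^{rt}\in K_h^{rt,*}$. Moreover, for every such $u_h^{cr}$ and $z_h^{rt}$, the discrete primal-dual total error equals the discrete primal-dual gap: $$\big(I_h^{cr}(v_h)-I_h^{cr}(u_h^{cr})\big)+\big(-D_h^{rt}(y_h)+D_h^{rt}(z_h^{rt})\big)=I_h^{cr}(v_h)-D_h^{rt}(y_h).$$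 -/

import Mathlib

open scoped MeasureTheory

noncomputable section

namespace Insulation

/-- `d`-dimensional Euclidean space. -/
abbrev Space (d : ℕ) : Type := EuclideanSpace ℝ (Fin d)

/-- The closed simplex with vertex set `s`. -/
abbrev body {d : ℕ} (s : Finset (Space d)) : Set (Space d) :=
  convexHull ℝ (s : Set (Space d))

/-- The `(d-1)`-dimensional surface measure (normalised Hausdorff measure; counting measure
if `d = 1`), restricted to the simplex with vertex set `S`. -/
abbrev surface {d : ℕ} (S : Finset (Space d)) : MeasureTheory.Measure (Space d) :=
  (μHE[d - 1] : MeasureTheory.Measure (Space d)).restrict (body S)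

/-- A (conforming) triangulation of `Ω`: a finite simplicial complex, each of whose simplices is
a face of a `d`-dimensional one, and which covers exactly the closure of `Ω`. -/
structure Triangulation {d : ℕ} (Ω : Set (Space d)) where
  complex : Geometry.SimplicialComplex ℝ (Space d)
  finite_faces : complex.faces.Finite
  pure : ∀ s ∈ complex.faces, ∃ t ∈ complex.faces, s ⊆ t ∧ t.card = d + 1
  space_eq : complex.space = closure Ω

/-- The splitting of the boundary of `Ω` into disjoint, relatively open parts: the insulated part
`I` (non-empty), the Dirichlet part `D` and the Neumann part `N`. -/
structure BoundarySplitting {d : ℕ} (Ω : Set (Space d)) where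
  I : Set (Space d)
  D : Set (Space d)
  N : Set (Space d)
  openI : ∃ U : Set (Space d), IsOpen U ∧ I = U ∩ frontier Ω
  openD : ∃ U : Set (Space d), IsOpen U ∧ D = U ∩ frontier Ω
  openN : ∃ U : Set (Space d), IsOpen U ∧ N = U ∩ frontier Ω
  disjointID : Disjoint I D
  disjointIN : Disjoint I N
  disjointDN : Disjoint D N
  nonemptyI : I.Nonempty
  cover : frontier Ω = closure I ∪ closure D ∪ closure N

/-- `n` is an outward unit normal vector to the simplex with vertex set `T` along its face with
vertex set `S`. -/
def IsOutwardUnitNormal {d : ℕ} (T S : Finset (Space d)) (n : Space d) : Prop :=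
  ‖n‖ = 1 ∧ (∀ p ∈ S, ∀ q ∈ S, inner ℝ n (q - p) = 0) ∧
    ∀ p ∈ T, p ∉ S → ∀ q ∈ S, inner ℝ n (p - q) < 0

/-- The outward unit normal vector to the simplex `T` along its side `S`. -/
def outwardNormal {d : ℕ} (T S : Finset (Space d)) : Space d :=
  Classical.epsilon (IsOutwardUnitNormal T S)

/-- The outward unit normal vector to a non-degenerate simplex along a side exists. -/
theorem isOutwardUnitNormal_outwardNormal {d : ℕ} {T S : Finset (Space d)}
    (hT : AffineIndependent ℝ ((↑) : T → Space d)) (hST : S ⊆ T) (hS : S.Nonempty)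
    (hcard : T.card = S.card + 1) : IsOutwardUnitNormal T S (outwardNormal T S) := by
  classical
  apply Classical.epsilon_spec (p := IsOutwardUnitNormal T S)
  obtain ⟨s, hs⟩ := hS
  obtain ⟨p, hp⟩ : ∃ p, T \ S = {p} := by
    rw [← Finset.card_eq_one, Finset.card_sdiff_of_subset hST]; omega
  have hpT : p ∈ T ∧ p ∉ S := by
    have : p ∈ T \ S := by rw [hp]; simp
    simpa using this
  have hpu : ∀ q ∈ T, q ∉ S → q = p := by
    intro q h1 h2
    have : q ∈ T \ S := by simp [h1, h2]
    rw [hp] at this; simpa using this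
  set V := vectorSpan ℝ (S : Set (Space d)) with hV
  have hsub : ∀ a ∈ S, ∀ b ∈ S, a - b ∈ V := fun a ha b hb =>
    vsub_mem_vectorSpan ℝ (by exact_mod_cast ha) (by exact_mod_cast hb)
  have hpn : p ∉ affineSpan ℝ (S : Set (Space d)) := by
    have h := hT.notMem_affineSpan_sdiff ⟨p, hpT.1⟩ {x : T | (x : Space d) ∈ S}
    have himg : ((↑) : T → Space d) '' ({x : T | (x : Space d) ∈ S} \ {⟨p, hpT.1⟩})
        = (S : Set (Space d)) := by
      ext x
      constructor
      · rintro ⟨y, ⟨hy, -⟩, rfl⟩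
        exact hy
      · intro hx
        have hx' : x ∈ S := by exact_mod_cast hx
        refine ⟨⟨x, hST hx'⟩, ⟨hx', ?_⟩, rfl⟩
        intro h
        have : x = p := congrArg Subtype.val h
        exact hpT.2 (this ▸ hx')
    rwa [himg] at h
  have hw : s - p ∉ V := by
    intro h
    apply hpn
    have h2 := AffineSubspace.vadd_mem_of_mem_direction
      (s := affineSpan ℝ (S : Set (Space d))) (v := -(s - p)) (p := s)
      (by rw [direction_affineSpan]; exact V.neg_mem h)
      (subset_affineSpan ℝ _ (by exact_mod_cast hs))
    simpa using h2
  set n₀ := (s - p) - V.starProjection (s - p) with hn₀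
  have horth : ∀ v ∈ V, inner ℝ n₀ v = 0 := fun v hv =>
    Submodule.starProjection_inner_eq_zero (K := V) (s - p) v hv
  have hne : n₀ ≠ 0 := by
    intro h
    apply hw
    rw [sub_eq_zero.1 h]
    exact Submodule.starProjection_apply_mem V _
  have hnorm : 0 < ‖n₀‖ := norm_pos_iff.2 hne
  have hself : inner ℝ n₀ (s - p) = ‖n₀‖ ^ 2 := by
    have : s - p = n₀ + V.starProjection (s - p) := by rw [hn₀]; abel
    rw [this, inner_add_right, horth _ (Submodule.starProjection_apply_mem V _),
      real_inner_self_eq_norm_sq, add_zero]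
  refine ⟨‖n₀‖⁻¹ • n₀, ?_, ?_, ?_⟩
  · rw [norm_smul, norm_inv, norm_norm, inv_mul_cancel₀ hnorm.ne']
  · intro a ha b hb
    rw [inner_smul_left, horth _ (hsub b hb a ha), mul_zero]
  · intro q hq hqS a ha
    rw [hpu q hq hqS, inner_smul_left]
    have : p - a = -(s - p) + (s - a) := by abel
    rw [this, inner_add_right, inner_neg_right, hself, horth _ (hsub s hs a ha)]
    simp only [conj_trivial]
    have : 0 < ‖n₀‖⁻¹ * ‖n₀‖ ^ 2 := by positivity
    linarith

namespace Triangulation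

variable {d : ℕ} {Ω : Set (Space d)} (M : Triangulation Ω)

open Classical in
/-- The elements (vertex sets of the `d`-simplices) of the triangulation. -/
def cells : Finset (Finset (Space d)) :=
  M.finite_faces.toFinset.filter fun s => s.card = d + 1

open Classical in
/-- The sides (vertex sets of the `(d-1)`-simplices) of the triangulation. -/
def sides : Finset (Finset (Space d)) :=
  M.finite_faces.toFinset.filter fun s => s.card = d

/-- Interior sides: common sides of two different elements. -/
def IsInteriorSide (S : M.sides) : Prop :=
  ∃ T T' : M.cells, T ≠ T' ∧ S.1 ⊆ T.1 ∧ S.1 ⊆ T'.1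

/-- Boundary sides: sides contained in the topological boundary of `Ω`. -/
def IsBoundarySide (S : M.sides) : Prop :=
  body S.1 ⊆ frontier Ω

open Classical in
/-- The boundary sides whose relative interior is contained in the boundary part `Γ`. -/
def sidesIn (Γ : Set (Space d)) : Finset M.sides :=
  Finset.univ.filter fun S => M.IsBoundarySide S ∧ intrinsicInterior ℝ (body S.1) ⊆ Γ

/-- The boundary sides are the disjoint union of those in the insulated, the Dirichlet and the
Neumann part (disjointness is automatic, as these parts are disjoint). -/
def Resolves (B : BoundarySplitting Ω) : Prop :=
  ∀ S : M.sides, M.IsBoundarySide S →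
    S ∈ M.sidesIn B.I ∨ S ∈ M.sidesIn B.D ∨ S ∈ M.sidesIn B.N

theorem exists_cell (S : M.sides) : ∃ T : M.cells, S.1 ⊆ T.1 := by
  obtain ⟨S, hS⟩ := S
  simp only [sides, Finset.mem_filter, Set.Finite.mem_toFinset] at hS
  obtain ⟨T, hT, hST, hc⟩ := M.pure S hS.1
  exact ⟨⟨T, by simp [cells, hT, hc]⟩, hST⟩

/-- An element containing the side `S`; it is unique if `S` is a boundary side. -/
def cellOf (S : M.sides) : M.cells := Classical.choose (M.exists_cell S)

/-- Element-wise affine functions: as the elements are non-degenerate, an affine function on an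
element is the same as an affine function on the whole space. -/
abbrev BrokenP1 : Type := M.cells → (Space d →ᵃ[ℝ] ℝ)

/-- Element-wise affine vector fields. -/
abbrev BrokenP1Vec : Type := M.cells → (Space d →ᵃ[ℝ] Space d)

variable {M}

/-- Element-wise gradient. -/
def grad (v : M.BrokenP1) (T : M.cells) : Space d :=
  (InnerProductSpace.toDual ℝ (Space d)).symm (LinearMap.toContinuousLinearMap (v T).linear)

/-- Element-wise divergence. -/
def div (y : M.BrokenP1Vec) (T : M.cells) : ℝ :=
  LinearMap.trace ℝ (Space d) (y T).linear

/-- Element-wise average of a function. -/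
def cellAvg (v : M.BrokenP1) (T : M.cells) : ℝ := ⨍ x in body T.1, v T x

/-- Element-wise average of a vector field. -/
def cellAvgVec (y : M.BrokenP1Vec) (T : M.cells) : Space d := ⨍ x in body T.1, y T x

/-- Average over a boundary side. -/
def sideAvg (v : M.BrokenP1) (S : M.sides) : ℝ := ⨍ x, v (M.cellOf S) x ∂(surface S.1)

/-- Outward normal trace on a boundary side. -/
def normalTrace (y : M.BrokenP1Vec) (S : M.sides) (x : Space d) : ℝ :=
  inner ℝ (y (M.cellOf S) x) (outwardNormal (M.cellOf S).1 S.1)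

variable (M)

/-- The Crouzeix--Raviart space: the jump across each interior side has vanishing average. -/
def CR : Set M.BrokenP1 :=
  {v | ∀ S : M.sides, M.IsInteriorSide S → ∀ T T' : M.cells, T ≠ T' → S.1 ⊆ T.1 → S.1 ⊆ T'.1 →
    ⨍ x, (v T x - v T' x) ∂(surface S.1) = 0}

/-- The lowest order Raviart--Thomas space: the normal component is constant on each side of each
element and the normal jump across each interior side vanishes. -/
def RT : Set M.BrokenP1Vec :=
  {y | (∀ (T : M.cells) (S : M.sides), S.1 ⊆ T.1 →
      ∃ c : ℝ, ∀ x ∈ body S.1, inner ℝ (y T x) (outwardNormal T.1 S.1) = c) ∧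
    ∀ S : M.sides, M.IsInteriorSide S → ∀ T T' : M.cells, T ≠ T' → S.1 ⊆ T.1 → S.1 ⊆ T'.1 →
      ∀ x ∈ body S.1,
        inner ℝ (y T x) (outwardNormal T.1 S.1) + inner ℝ (y T' x) (outwardNormal T'.1 S.1) = 0}

variable {M}

/-- `∫_Ω φ dx` for an element-wise given function `φ`. -/
def integral (φ : M.cells → Space d → ℝ) : ℝ := ∑ T : M.cells, ∫ x in body T.1, φ T x

/-- `∫_Γ φ ds` for a boundary part `Γ` and a function `φ` given side by side on `Γ`. -/
def surfaceIntegral (Γ : Set (Space d)) (φ : M.sidesIn Γ → Space d → ℝ) : ℝ :=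
  ∑ S : M.sidesIn Γ, ∫ x, φ S x ∂(surface S.1.1)

/-- The `L^∞(Γ)`-norm of a function given side by side on a boundary part `Γ`. -/
def surfaceSupNorm (Γ : Set (Space d)) (φ : M.sidesIn Γ → Space d → ℝ) : ℝ :=
  (Finset.univ.sup fun S : M.sidesIn Γ =>
    MeasureTheory.eLpNormEssSup (φ S) (surface S.1.1)).toReal

end Triangulation

open Classical in
/-- The convex indicator: `0` if the constraint holds and `+∞` otherwise. -/
def indicator (P : Prop) : EReal := if P then 0 else ⊤

open Triangulation

variable {d : ℕ} {Ω : Set (Space d)} (M : Triangulation Ω) (B : BoundarySplitting Ω) (m : ℝ)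
  (f : M.cells → ℝ) (g : M.sidesIn B.N → ℝ) (uD : M.sidesIn B.D → ℝ)

/-- The discrete primal energy functional. -/
def primalEnergy (v : M.BrokenP1) : EReal :=
  ((1 / 2 * integral (fun T _ => ‖grad v T‖ ^ 2)
      + 1 / (2 * m) * (surfaceIntegral B.I fun S _ => |sideAvg v S.1|) ^ 2
      - integral (fun T _ => f T * cellAvg v T)
      - surfaceIntegral B.N (fun S _ => g S * sideAvg v S.1) : ℝ) : EReal)
    + indicator (∀ S : M.sidesIn B.D, sideAvg v S.1 = uD S)

/-- The discrete dual energy functional. -/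
def dualEnergy (y : M.BrokenP1Vec) : EReal :=
  ((-(1 / 2) * integral (fun T _ => ‖cellAvgVec y T‖ ^ 2)
      - m / 2 * (surfaceSupNorm B.I fun S => normalTrace y S.1) ^ 2
      + surfaceIntegral B.D (fun S x => normalTrace y S.1 x * uD S) : ℝ) : EReal)
    - indicator (∀ T : M.cells, div y T = -f T)
    - indicator (∀ S : M.sidesIn B.N, ∀ᵐ x ∂(surface S.1.1), normalTrace y S.1 x = g S)

/-- The discrete primal admissible set: the effective domain of the discrete primal energy. -/
def primalSet : Set M.BrokenP1 := {v | v ∈ M.CR ∧ primalEnergy M B m f g uD v < ⊤}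

/-- The discrete dual admissible set: the effective domain of the negative of the discrete dual
energy. -/
def dualSet : Set M.BrokenP1Vec := {y | y ∈ M.RT ∧ -dualEnergy M B m f g uD y < ⊤}

/-- Discrete primal solutions: admissible minimisers of the discrete primal energy. -/
def IsPrimalSolution (u : M.BrokenP1) : Prop :=
  u ∈ primalSet M B m f g uD ∧ IsMinOn (primalEnergy M B m f g uD) M.CR u

/-- Discrete dual solutions: admissible maximisers of the discrete dual energy. -/
def IsDualSolution (z : M.BrokenP1Vec) : Prop :=
  z ∈ dualSet M B m f g uD ∧ IsMaxOn (dualEnergy M B m f g uD) M.RT z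

/-- Optimal strong convexity measure of the discrete primal energy at `u`. -/
def primalError (u v : M.BrokenP1) : EReal :=
  primalEnergy M B m f g uD v - primalEnergy M B m f g uD u

/-- Optimal strong convexity measure of the negative of the discrete dual energy at `z`. -/
def dualError (z y : M.BrokenP1Vec) : EReal :=
  -dualEnergy M B m f g uD y + dualEnergy M B m f g uD z

/-- The discrete primal-dual total error. -/
def totalError (u : M.BrokenP1) (z : M.BrokenP1Vec) (v : M.BrokenP1) (y : M.BrokenP1Vec) : EReal :=
  primalError M B m f g uD u v + dualError M B m f g uD z y

/-- The discrete primal-dual gap estimator. -/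
def gapEstimator (v : M.BrokenP1) (y : M.BrokenP1Vec) : EReal :=
  primalEnergy M B m f g uD v - dualEnergy M B m f g uD y

end Insulation

end

/-! The identity is strong duality in disguise: once the minimal primal and the maximal dual value
coincide, they cancel in the total error. What has to be shown is existence on both sides, absence
of a gap, and uniqueness of the dual maximiser.

Averages of affine maps over elements and sides are values at barycenters, so both energies become
finite sums. On one simplex the outward normals weighted by side areas are, up to the factor `-d
|T|`, the gradients of the barycentric coordinates (`area_mul_inner_outwardNormal`). This makes
integration by parts between affine functions and Raviart-Thomas fields exact (`sum_area_mul_eq`).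
Summed over the mesh, the interior sides cancel (`discrete_integration_by_parts`), because a side
lies either in two elements with opposite normals, or in one element and then on the boundary. The
gap `I(v) - D(y)` thereby becomes half the squared distance between the gradient of `v` and the
element averages of `y`, plus a Fenchel-Young remainder on the insulated sides
(`primalReal_sub_dualReal`). Both terms are non-negative, which is weak duality.

A dual admissible field bounds the primal energy from below. That energy is a positive definite
functional, homogeneous of degree two, of the gradient and the insulated side averages, minus a
linear load. Boundedness below forces the load to factor through these data along admissible
directions, so a minimiser `u` exists (`exists_forall_comp_sub_le`).

Strong duality comes from the explicit field `∇u - (f/d)(x - bary T)` on each element `T`. Its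
divergence is `-f` by construction. Testing the variational inequality of `u` with Crouzeix-Raviart
functions of arbitrary side averages shows that its normal jumps vanish, that it satisfies the
Neumann condition, and that minus its flux on the insulated sides is a subgradient of the squared
`ℓ¹` norm. The last fact gives equality in Fenchel-Young (`reconstruction_no_gap`).

Any dual maximiser then has no gap to `u`, so its element averages are the gradients of `u`. Since
average and divergence determine a Raviart-Thomas field on an element, the maximiser is unique. -/

noncomputable section

namespace Insulation

open MeasureTheory Module Topology

/-! ### Barycentric coordinates and averages of affine maps over simplices. -/

namespace AffineBasisAux

theorem affineMap_eq_sum {ι E F : Type*} [Fintype ι] [AddCommGroup E] [Module ℝ E]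
    [AddCommGroup F] [Module ℝ F] (b : AffineBasis ι ℝ E) (f : E →ᵃ[ℝ] F) (x : E) :
    f x = ∑ i, b.coord i x • f (b i) := by
  have h2 := Finset.map_affineCombination Finset.univ (b : ι → E) (fun i => b.coord i x)
    (b.sum_coord_apply_eq_one x) f
  rw [b.affineCombination_coord_eq_self,
    Finset.affineCombination_eq_linear_combination _ _ _ (b.sum_coord_apply_eq_one x)] at h2
  simpa using h2

end AffineBasisAux

section Average

variable {ι E F : Type*} [NormedAddCommGroup E] [NormedSpace ℝ E]
  [FiniteDimensional ℝ E] [MeasurableSpace E] [NormedAddCommGroup F] [NormedSpace ℝ F]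

theorem measure_convexHull_affineBasis_pos (b : AffineBasis ι ℝ E) (μ : Measure E)
    [μ.IsAddHaarMeasure] : 0 < μ (convexHull ℝ (Set.range b)) :=
  Measure.measure_pos_of_nonempty_interior μ
    (interior_convexHull_nonempty_iff_affineSpan_eq_top.2 b.tot)

variable [Fintype ι] [BorelSpace E]

/-- All barycentric coordinates have the same integral over a simplex. -/
theorem setIntegral_coord_eq (b : AffineBasis ι ℝ E) (μ : Measure E)
    [μ.IsAddHaarMeasure] (i j : ι) :
    ∫ x in convexHull ℝ (Set.range b), b.coord i x ∂μ =
      ∫ x in convexHull ℝ (Set.range b), b.coord j x ∂μ := by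
  classical
  rcases eq_or_ne i j with rfl | hij
  · rfl
  set c : E →ᵃ[ℝ] ℝ := b.coord i - b.coord j with hc
  -- `A` is the linear part of the affine involution `σ` that exchanges the vertices `b i` and `b j`
  -- and fixes the others. It preserves both the simplex and the measure, and it swaps the two
  -- coordinates.
  set A : E →ₗ[ℝ] E := LinearMap.id + c.linear.smulRight (b j - b i) with hA
  have hclin : c.linear (b j - b i) = -2 := by
    rw [← vsub_eq_sub, AffineMap.linearMap_vsub]
    simp [hc, b.coord_apply, hij, hij.symm]
    norm_num
  have hAA : A * A = 1 := by
    ext1 w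
    simp only [hA, Module.End.mul_apply, LinearMap.add_apply, LinearMap.id_apply,
      LinearMap.smulRight_apply, map_add, map_smul, hclin, Module.End.one_apply]
    module
  -- Being an involution, `A` has determinant `±1`, so no explicit determinant is needed.
  have hdet : |LinearMap.det A| = 1 := by
    have h := congrArg LinearMap.det hAA
    rw [map_mul, map_one] at h
    have h2 : |LinearMap.det A| * |LinearMap.det A| = 1 := by rw [← abs_mul, h, abs_one]
    nlinarith [abs_nonneg (LinearMap.det A)]
  set o : E := c 0 • (b j - b i) with ho
  set σ : E → E := fun x => A x + o with hσ
  have hσx : ∀ x, σ x = x + c x • (b j - b i) := by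
    intro x
    have : c x = c.linear x + c 0 := by
      have := c.map_vadd 0 x
      simpa using this
    simp only [hσ, hA, ho, this, LinearMap.add_apply, LinearMap.id_apply,
      LinearMap.smulRight_apply]
    module
  have hmp : MeasurePreserving σ μ μ := by
    have h1 : MeasurePreserving A μ μ := by
      refine ⟨A.continuous_of_finiteDimensional.measurable, ?_⟩
      have hne : LinearMap.det A ≠ 0 := by
        intro h; rw [h] at hdet; simp at hdet
      rw [Measure.map_linearMap_addHaar_eq_smul_addHaar μ hne, abs_inv, hdet]
      simp
    exact (measurePreserving_add_right μ o).comp h1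
  have hcoord : ∀ k x, b.coord k (σ x) = b.coord (Equiv.swap i j k) x := by
    intro k x
    have h1 : b.coord k (σ x) = b.coord k x + c x * (b.coord k).linear (b j - b i) := by
      rw [hσx, add_comm, ← vadd_eq_add, AffineMap.map_vadd]
      simp [add_comm]
    rw [h1, ← vsub_eq_sub, AffineMap.linearMap_vsub, b.coord_apply, b.coord_apply]
    rcases eq_or_ne k i with rfl | hki
    · simp [hc, hij]
    rcases eq_or_ne k j with rfl | hkj
    · simp [hc, hki]
    · simp [Equiv.swap_apply_of_ne_of_ne hki hkj, hki, hkj]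
  have hpre : σ ⁻¹' (convexHull ℝ (Set.range b)) = convexHull ℝ (Set.range b) := by
    ext x
    rw [b.convexHull_eq_nonneg_coord]
    simp only [Set.mem_preimage, Set.mem_ofPred_eq, hcoord]
    exact ⟨fun h k => by simpa using h (Equiv.swap i j k), fun h k => h _⟩
  have hσσ : ∀ x, σ (σ x) = x := by
    intro x
    have : ∀ k, b.coord k (σ (σ x)) = b.coord k x := by intro k; simp [hcoord]
    exact b.ext_elem this
  have hcont : Continuous σ := by
    simp only [hσ]
    exact A.continuous_of_finiteDimensional.add continuous_const
  have hemb : MeasurableEmbedding σ :=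
    (Homeomorph.mk ⟨σ, σ, hσσ, hσσ⟩ hcont hcont).measurableEmbedding
  have h := hmp.setIntegral_preimage_emb hemb (fun x => b.coord i x)
    (convexHull ℝ (Set.range b))
  rw [← h, hpre]
  refine integral_congr_ae (Filter.Eventually.of_forall fun x => ?_)
  simp [hcoord]

/-- The average of an affine map over a simplex is its value at the barycenter. -/
theorem setAverage_affineMap [CompleteSpace F] (b : AffineBasis ι ℝ E) (μ : Measure E)
    [μ.IsAddHaarMeasure] (f : E →ᵃ[ℝ] F) :
    ⨍ x in convexHull ℝ (Set.range b), f x ∂μ = (Fintype.card ι : ℝ)⁻¹ • ∑ i, f (b i) := by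
  classical
  set K := convexHull ℝ (Set.range b) with hK
  have hKc : IsCompact K := (Set.finite_range b).isCompact_convexHull ℝ
  have hpos : 0 < μ.real K :=
    ENNReal.toReal_pos (measure_convexHull_affineBasis_pos b μ).ne' hKc.measure_lt_top.ne
  have hcont : ∀ i, Continuous fun x => b.coord i x := fun i => continuous_barycentric_coord b i
  have hint : ∀ i, IntegrableOn (fun x => b.coord i x) K μ := fun i =>
    (hcont i).continuousOn.integrableOn_compact hKc
  have : Nonempty ι := by
    by_contra h
    rw [not_nonempty_iff] at h
    simp [hK, Set.range_eq_empty] at hpos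
  obtain ⟨i₀⟩ := this
  -- The coordinates sum to one and have equal integrals, so each integral is an equal share of the
  -- measure of the simplex.
  have hsum : (Fintype.card ι : ℝ) * ∫ x in K, b.coord i₀ x ∂μ = μ.real K := by
    have h1 : ∑ i, ∫ x in K, b.coord i x ∂μ = μ.real K := by
      rw [← integral_finsetSum _ fun i _ => hint i]
      simp [b.sum_coord_apply_eq_one]
    rw [← h1, Finset.sum_congr rfl fun i _ => setIntegral_coord_eq b μ i i₀]
    simp [hK]
  have hcard : (Fintype.card ι : ℝ) ≠ 0 := by
    have : 0 < Fintype.card ι := Fintype.card_pos_iff.2 ⟨i₀⟩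
    positivity
  have hI : ∀ i, ∫ x in K, b.coord i x ∂μ = (Fintype.card ι : ℝ)⁻¹ * μ.real K := by
    intro i
    rw [setIntegral_coord_eq b μ i i₀, ← hsum, inv_mul_cancel_left₀ hcard]
  rw [setAverage_eq]
  rw [show (fun x => f x) = fun x => ∑ i, b.coord i x • f (b i) from
      funext (AffineBasisAux.affineMap_eq_sum b f),
    integral_finsetSum _ fun i _ => (hint i).smul_const _]
  simp_rw [integral_smul_const, hI]
  rw [← Finset.smul_sum, smul_smul]
  congr 1
  field_simp

end Average

/-- The barycenter of a finite set of points. -/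
def bary {d : ℕ} (s : Finset (Space d)) : Space d := (s.card : ℝ)⁻¹ • ∑ p ∈ s, p

theorem affineMap_bary {d : ℕ} {F : Type*} [AddCommGroup F] [Module ℝ F]
    {s : Finset (Space d)} (hs : s.Nonempty) (f : Space d →ᵃ[ℝ] F) :
    f (bary s) = (s.card : ℝ)⁻¹ • ∑ p ∈ s, f p := by
  have hf : ∀ x, f x = f.linear x + f 0 := fun x => by simpa using f.map_vadd 0 x
  have hc : (s.card : ℝ) ≠ 0 := by exact_mod_cast hs.card_ne_zero
  rw [hf (bary s), bary, map_smul, map_sum, Finset.sum_congr rfl fun p _ => hf p,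
    Finset.sum_add_distrib, smul_add, Finset.sum_const, ← Nat.cast_smul_eq_nsmul ℝ, smul_smul,
    inv_mul_cancel₀ hc, one_smul]

theorem bary_mem_body {d : ℕ} {s : Finset (Space d)} (hs : s.Nonempty) : bary s ∈ body s := by
  have hc : (s.card : ℝ) ≠ 0 := by exact_mod_cast hs.card_ne_zero
  rw [bary, Finset.smul_sum]
  exact (convex_convexHull ℝ _).sum_mem (fun _ _ => by positivity) (by simp [hc])
    fun p hp => subset_convexHull ℝ _ hp

theorem isCompact_body {d : ℕ} (s : Finset (Space d)) : IsCompact (body s) :=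
  s.finite_toSet.isCompact_convexHull ℝ

/-- The affine basis formed by the vertices of a non-degenerate simplex. -/
def vertexBasis {d : ℕ} {T : Finset (Space d)} (hT : AffineIndependent ℝ ((↑) : T → Space d))
    (hcard : T.card = d + 1) : AffineBasis T ℝ (Space d) where
  toFun := (↑)
  ind' := hT
  tot' := by
    rw [hT.affineSpan_eq_top_iff_card_eq_finrank_add_one]
    simp [hcard]

theorem coe_vertexBasis {d : ℕ} {T : Finset (Space d)}
    (hT : AffineIndependent ℝ ((↑) : T → Space d)) (hcard : T.card = d + 1) :
    (vertexBasis hT hcard : T → Space d) = (↑) := rfl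

theorem range_vertexBasis {d : ℕ} {T : Finset (Space d)}
    (hT : AffineIndependent ℝ ((↑) : T → Space d)) (hcard : T.card = d + 1) :
    Set.range (vertexBasis hT hcard) = (T : Set (Space d)) := by
  rw [coe_vertexBasis]; simp

theorem volume_body_pos {d : ℕ} {T : Finset (Space d)}
    (hT : AffineIndependent ℝ ((↑) : T → Space d)) (hcard : T.card = d + 1) :
    0 < volume.real (body T) := by
  have h := measure_convexHull_affineBasis_pos (vertexBasis hT hcard) volume
  rw [range_vertexBasis] at h
  exact ENNReal.toReal_pos h.ne' (isCompact_body T).measure_lt_top.ne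

theorem setAverage_body {d : ℕ} {F : Type*} [NormedAddCommGroup F] [NormedSpace ℝ F]
    [CompleteSpace F] {T : Finset (Space d)}
    (hT : AffineIndependent ℝ ((↑) : T → Space d)) (hcard : T.card = d + 1)
    (f : Space d →ᵃ[ℝ] F) : ⨍ x in body T, f x = f (bary T) := by
  have h := setAverage_affineMap (vertexBasis hT hcard) volume f
  rw [range_vertexBasis, coe_vertexBasis] at h
  rw [h, affineMap_bary (Finset.card_pos.1 (by omega)), Fintype.card_coe,
    ← Finset.sum_coe_sort T]

/-! ### Surface measure of a side and the cone formula. -/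

/-- The `k`-dimensional surface measure on a `k`-simplex is the isometric image of the Lebesgue
measure on a simplex in a `k`-dimensional inner product space. -/
theorem exists_isometric_model {d k : ℕ} {S : Finset (Space d)}
    (hS : AffineIndependent ℝ ((↑) : S → Space d)) (hcard : S.card = k + 1) :
    ∃ (V : Submodule ℝ (Space d)) (b : AffineBasis S ℝ V) (J : V →ᵃ[ℝ] Space d),
      MeasurableEmbedding J ∧ (∀ q, J (b q) = q) ∧
      (μHE[k] : Measure (Space d)).restrict (body S) =
        ((volume : Measure V).restrict (convexHull ℝ (Set.range b))).map J := by
  obtain ⟨s₀, hs₀⟩ : S.Nonempty := Finset.card_pos.1 (by omega)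
  set V := vectorSpan ℝ (S : Set (Space d)) with hV
  have hVfin : finrank ℝ V = k := by
    have h := hS.finrank_vectorSpan (n := k) (by simpa using hcard)
    rwa [Subtype.range_coe_subtype] at h
  -- Translating the direction space by a vertex is an isometry onto the affine span, and Hausdorff
  -- measure is transported by isometries.
  let J : V →ᵃ[ℝ] Space d := V.subtype.toAffineMap + AffineMap.const ℝ V s₀
  have hJ : ∀ y, J y = y + s₀ := fun y => rfl
  have hJiso : Isometry J := Isometry.of_dist_eq fun x y => by rw [hJ, hJ, dist_add_right]; rfl
  let P : S → V := fun q => ⟨q - s₀, vsub_mem_vectorSpan ℝ (by simp) (by simpa using hs₀)⟩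
  have hJP : ∀ q, J (P q) = q := fun q => by simp [hJ, P]
  have hPind : AffineIndependent ℝ P := by
    refine AffineIndependent.of_comp J ?_
    rwa [show J ∘ P = ((↑) : S → Space d) from funext hJP]
  let b : AffineBasis S ℝ V := ⟨P, hPind, by
    rw [hPind.affineSpan_eq_top_iff_card_eq_finrank_add_one, hVfin]; simpa using hcard⟩
  have hb : (b : S → V) = P := rfl
  have hmeas : MeasurableEmbedding J := hJiso.isClosedEmbedding.measurableEmbedding
  refine ⟨V, b, J, hmeas, hJP, ?_⟩
  have himg : J '' convexHull ℝ (Set.range b) = body S := by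
    rw [AffineMap.image_convexHull, ← Set.range_comp, hb,
      show J ∘ P = ((↑) : S → Space d) from funext hJP]
    simp
  have hpre : J ⁻¹' body S = convexHull ℝ (Set.range b) := by
    rw [← himg, Set.preimage_image_eq _ hJiso.injective]
  have h1 := hJiso.map_euclideanHausdorffMeasure (d := k)
  have h2 : (μHE[k] : Measure V) = volume := by
    rw [← hVfin]; exact InnerProductSpace.euclideanHausdorffMeasure_eq_volume
  rw [h2] at h1
  rw [← hpre, ← hmeas.restrict_map, h1, Measure.restrict_restrict (isCompact_body S).measurableSet,
    Set.inter_eq_left.2]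
  rw [← himg]
  exact Set.image_subset_range _ _

/-- In the isometric model the surface measure is Lebesgue measure and `f` stays affine, so the
full-dimensional average formula applies. -/
theorem average_hausdorff_body {d k : ℕ} {F : Type*} [NormedAddCommGroup F] [NormedSpace ℝ F]
    [CompleteSpace F] {S : Finset (Space d)}
    (hS : AffineIndependent ℝ ((↑) : S → Space d)) (hcard : S.card = k + 1)
    (f : Space d →ᵃ[ℝ] F) :
    ⨍ x, f x ∂(μHE[k] : Measure (Space d)).restrict (body S) = f (bary S) := by
  obtain ⟨V, b, J, hJ, hJb, h⟩ := exists_isometric_model hS hcard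
  have h1 := setAverage_affineMap b volume (f.comp J)
  rw [h, average_eq, hJ.integral_map, Measure.real, hJ.map_apply, Set.preimage_univ]
  rw [average_eq] at h1
  rw [affineMap_bary (Finset.card_pos.1 (by omega)), ← Finset.sum_coe_sort S]
  simpa [hJb, Measure.real] using h1

/-- The volume of a cone: `d` times the volume of a simplex is the product of the measure of a side
and the corresponding height. -/
theorem natCast_mul_volume_body {d : ℕ} (hd : 1 ≤ d) {S : Finset (Space d)} (hS : S.Nonempty)
    {p n : Space d} {h : ℝ} (hh : 0 < h) (hn : ‖n‖ = 1)
    (hnS : ∀ q ∈ S, inner ℝ n (q - p) = h) :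
    volume (convexHull ℝ (insert p (S : Set (Space d)))) =
      μHE[d - 1] (body S) * ENNReal.ofReal (h / d) := by
  set T := convexHull ℝ (insert p (S : Set (Space d))) with hT
  have hTm : MeasurableSet T :=
    ((S.finite_toSet.insert p).isCompact_convexHull ℝ).measurableSet
  have hn0 : n ≠ 0 := by rintro rfl; simp at hn
  have hF := EuclideanGeometry.euclideanHausdorffMeasure_eq_lintegral p hn0 hTm
  rw [finrank_euclideanSpace_fin, EuclideanSpace.euclideanHausdorffMeasure_eq_volume] at hF
  have hne : ‖n‖ₑ = 1 := by rw [← ofReal_norm, hn]; simp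
  rw [hne, one_mul] at hF
  have hbody : ∀ x ∈ body S, inner ℝ n (x - p) = h := by
    intro x hx
    have hconv : Convex ℝ {x : Space d | inner ℝ n (x - p) = h} := by
      have : {x : Space d | inner ℝ n (x - p) = h} = {x | (innerₗ (Space d) n) x = h + inner ℝ n p} := by
        ext x
        simp only [Set.mem_ofPred_eq, inner_sub_right, innerₗ_apply_apply]
        constructor <;> intro h <;> linarith
      rw [this]
      exact convex_hyperplane (innerₗ (Space d) n).isLinear _
    exact convexHull_min (fun q hq => hnS q hq) hconv hx
  have hmem : ∀ x, x ∈ T ↔ ∃ q ∈ body S, ∃ s ∈ Set.Icc (0 : ℝ) 1, x = AffineMap.homothety p s q := by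
    intro x
    rw [hT, convexHull_insert (by exact_mod_cast hS)]
    simp only [mem_convexJoin, Set.mem_singleton_iff, exists_eq_left, segment_eq_image_lineMap]
    constructor
    · rintro ⟨q, hq, s, hs, rfl⟩
      exact ⟨q, hq, s, hs, by simp [AffineMap.homothety_apply, AffineMap.lineMap_apply]⟩
    · rintro ⟨q, hq, s, hs, rfl⟩
      exact ⟨q, hq, s, hs, by simp [AffineMap.homothety_apply, AffineMap.lineMap_apply]⟩
  have hlev : ∀ (s : ℝ), ∀ q ∈ body S, inner ℝ n (AffineMap.homothety p s q - p) = s * h := by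
    intro s q hq
    simp [AffineMap.homothety_apply, inner_smul_right, hbody q hq]
  have hplane : ∀ (t : ℝ) x, x ∈ AffineSubspace.mk' (t • n +ᵥ p) (ℝ ∙ n)ᗮ ↔
      inner ℝ n (x - p) = t := by
    intro t x
    rw [AffineSubspace.mem_mk', Submodule.mem_orthogonal_singleton_iff_inner_right]
    simp only [vsub_eq_sub, vadd_eq_add, inner_sub_right, inner_add_right, inner_smul_right,
      real_inner_self_eq_norm_sq, hn]
    constructor <;> intro h <;> linarith
  -- The slice at height `t` is the base shrunk towards the apex by the ratio `t / h`, so its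
  -- measure scales with the power `d - 1`. Height zero is left out because the scaling rule needs a
  -- non-zero ratio; it is a null set of heights.
  have hslice : ∀ t : ℝ, t ≠ 0 →
      μHE[d - 1] (T ∩ AffineSubspace.mk' (t • n +ᵥ p) (ℝ ∙ n)ᗮ) =
        (Set.Icc 0 h).indicator
          (fun t => ENNReal.ofReal ((t / h) ^ (d - 1)) * μHE[d - 1] (body S)) t := by
    intro t ht0
    by_cases ht : t ∈ Set.Icc 0 h
    · rw [Set.indicator_of_mem ht]
      have hpos : 0 < t / h := div_pos (lt_of_le_of_ne ht.1 ht0.symm) hh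
      have : T ∩ AffineSubspace.mk' (t • n +ᵥ p) (ℝ ∙ n)ᗮ =
          AffineMap.homothety p (t / h) '' body S := by
        ext x
        simp only [Set.mem_inter_iff, hmem, SetLike.mem_coe, hplane, Set.mem_image]
        constructor
        · rintro ⟨⟨q, hq, s, hs, rfl⟩, hx⟩
          rw [hlev s q hq] at hx
          exact ⟨q, hq, by rw [← hx, mul_div_cancel_right₀ _ hh.ne']⟩
        · rintro ⟨q, hq, rfl⟩
          refine ⟨⟨q, hq, t / h, ⟨hpos.le, (div_le_one hh).2 ht.2⟩, rfl⟩, ?_⟩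
          rw [hlev _ q hq, div_mul_cancel₀ _ hh.ne']
      rw [this, euclideanHausdorffMeasure_homothety_image _ _ hpos.ne', ENNReal.smul_def,
        smul_eq_mul]
      congr 1
      rw [ENNReal.ofReal_pow hpos.le, ENNReal.coe_pow]
      congr 1
      rw [← enorm_eq_nnnorm, Real.enorm_eq_ofReal hpos.le]
    · rw [Set.indicator_of_notMem ht]
      have : T ∩ AffineSubspace.mk' (t • n +ᵥ p) (ℝ ∙ n)ᗮ = ∅ := by
        rw [Set.eq_empty_iff_forall_notMem]
        rintro x ⟨hxT, hx⟩
        rw [SetLike.mem_coe, hplane] at hx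
        obtain ⟨q, hq, s, hs, rfl⟩ := (hmem x).1 hxT
        rw [hlev s q hq] at hx
        apply ht
        rw [← hx]
        exact ⟨mul_nonneg hs.1 hh.le, mul_le_of_le_one_left hh.le hs.2⟩
      rw [this, measure_empty]
  rw [hF, lintegral_congr_ae (g := (Set.Icc 0 h).indicator
    (fun t => ENNReal.ofReal ((t / h) ^ (d - 1)) * μHE[d - 1] (body S)))
    (by filter_upwards [Measure.ae_ne volume (0 : ℝ)] with t ht using hslice t ht),
    lintegral_indicator measurableSet_Icc, lintegral_mul_const _ (by fun_prop), mul_comm]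
  congr 1
  rw [← ofReal_integral_eq_lintegral_ofReal]
  · congr 1
    rw [integral_Icc_eq_integral_Ioc, ← intervalIntegral.integral_of_le hh.le]
    simp_rw [div_pow]
    rw [intervalIntegral.integral_div, integral_pow]
    have : ((d - 1 : ℕ) : ℝ) + 1 = d := by rw [Nat.cast_sub hd]; simp
    rw [this, Nat.sub_add_cancel hd]
    obtain ⟨k, rfl⟩ : ∃ k, d = k + 1 := ⟨d - 1, by omega⟩
    simp only [Nat.add_sub_cancel, pow_succ]
    field_simp
    ring
  · exact (Continuous.continuousOn (by fun_prop)).integrableOn_compact isCompact_Icc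
  · refine (ae_restrict_iff' measurableSet_Icc).2 (Filter.Eventually.of_forall fun t ht => ?_)
    have := ht.1
    exact pow_nonneg (div_nonneg ht.1 hh.le) _

/-- The surface area of the side with vertex set `S`. -/
def area {d : ℕ} (S : Finset (Space d)) : ℝ :=
  (μHE[d - 1] : Measure (Space d)).real (body S)

/-! ### One simplex: normals, coordinate gradients and Raviart-Thomas fields. -/

namespace AffineBasisAux

variable {ι E F : Type*} [Fintype ι] [AddCommGroup E] [Module ℝ E] [AddCommGroup F] [Module ℝ F]
  (b : AffineBasis ι ℝ E)

theorem sum_coord_linear (w : E) : ∑ i, (b.coord i).linear w = 0 := by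
  have h1 := b.sum_coord_apply_eq_one (w +ᵥ (0 : E))
  have h2 := b.sum_coord_apply_eq_one (0 : E)
  simp_rw [AffineMap.map_vadd, vadd_eq_add, Finset.sum_add_distrib] at h1
  linarith

theorem linear_eq_sum (f : E →ᵃ[ℝ] F) (w : E) :
    f.linear w = ∑ i, (b.coord i).linear w • f (b i) := by
  have h1 := affineMap_eq_sum b f (w +ᵥ (0 : E))
  have h2 := affineMap_eq_sum b f (0 : E)
  simp_rw [AffineMap.map_vadd, vadd_eq_add, add_smul, Finset.sum_add_distrib] at h1
  rw [← h2] at h1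
  exact add_right_cancel h1

theorem sum_coord_linear_smul (w : E) : ∑ i, (b.coord i).linear w • b i = w := by
  have := linear_eq_sum b (AffineMap.id ℝ E) w
  simpa using this.symm

theorem trace_linear_eq_sum [FiniteDimensional ℝ E] (y : E →ᵃ[ℝ] E) :
    LinearMap.trace ℝ E y.linear = ∑ i, (b.coord i).linear (y (b i)) := by
  have h : y.linear = ∑ i, ((b.coord i).linear).smulRight (y (b i)) := by
    ext1 w
    simp [linear_eq_sum b y w, LinearMap.sum_apply]
  rw [h, map_sum]
  simp [LinearMap.trace_smulRight]

end AffineBasisAux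

open AffineBasisAux

section Cell

variable {d : ℕ} {T : Finset (Space d)}

theorem insert_erase_coe (p : T) :
    (T : Set (Space d)) = insert (p : Space d) ((T.erase p : Finset (Space d)) : Set (Space d)) := by
  rw [← Finset.coe_insert, Finset.insert_erase p.2]

theorem card_erase (hcard : T.card = d + 1) (p : T) : (T.erase (p : Space d)).card = d := by
  rw [Finset.card_erase_of_mem p.2, hcard, Nat.add_sub_cancel]

theorem erase_nonempty (hd : 1 ≤ d) (hcard : T.card = d + 1) (p : T) :
    (T.erase (p : Space d)).Nonempty :=
  Finset.card_pos.1 (by rw [card_erase hcard p]; omega)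

theorem isOutwardUnitNormal_erase (hd : 1 ≤ d) (hT : AffineIndependent ℝ ((↑) : T → Space d))
    (hcard : T.card = d + 1) (p : T) :
    IsOutwardUnitNormal T (T.erase p) (outwardNormal T (T.erase p)) :=
  isOutwardUnitNormal_outwardNormal hT (Finset.erase_subset _ _) (erase_nonempty hd hcard p)
    (by rw [card_erase hcard p, hcard])

variable (hd : 1 ≤ d) (hT : AffineIndependent ℝ ((↑) : T → Space d)) (hcard : T.card = d + 1)

include hd in
/-- The weighted outward normals are multiples of the gradients of the barycentric coordinates. -/
theorem area_mul_inner_outwardNormal (p : T) (w : Space d) :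
    area (T.erase (p : Space d)) * inner ℝ (outwardNormal T (T.erase (p : Space d))) w =
      -(d * volume.real (body T)) * ((vertexBasis hT hcard).coord p).linear w := by
  set n := outwardNormal T (T.erase (p : Space d))
  obtain ⟨hn1, hn2, hn3⟩ := isOutwardUnitNormal_erase hd hT hcard p
  obtain ⟨q₀, hq₀⟩ := erase_nonempty hd hcard p
  set h := inner ℝ n (q₀ - p) with hh
  have hpos : 0 < h := by
    have := hn3 p p.2 (by simp) q₀ hq₀
    rw [← neg_sub, inner_neg_right] at this
    linarith
  have hS : ∀ q ∈ T.erase (p : Space d), inner ℝ n (q - p) = h := by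
    intro q hq
    have := hn2 q₀ hq₀ q hq
    rw [hh, ← sub_add_sub_cancel q q₀ p, inner_add_right, this, zero_add]
  have hvol := natCast_mul_volume_body hd ⟨q₀, hq₀⟩ hpos hn1 hS
  rw [← insert_erase_coe] at hvol
  have hvol' : d * volume.real (body T) = area (T.erase (p : Space d)) * h := by
    have hd0 : (d : ℝ) ≠ 0 := by positivity
    rw [Measure.real, hvol, ENNReal.toReal_mul, ENNReal.toReal_ofReal (by positivity), area,
      Measure.real]
    field_simp
  -- Write `w` as a combination of the edges `q - p`. Each edge with `q ≠ p` has normal component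
  -- `h`, and the weights sum to zero, so only the weight at `p` survives.
  have hw : inner ℝ n w = -h * ((vertexBasis hT hcard).coord p).linear w := by
    set b := vertexBasis hT hcard with hb
    have h1 : w = ∑ q, (b.coord q).linear w • ((q : Space d) - p) := by
      have := sum_coord_linear_smul b w
      simp only [smul_sub, Finset.sum_sub_distrib, ← Finset.sum_smul, sum_coord_linear, zero_smul,
        sub_zero]
      exact this.symm
    have h2 : ∀ q : T, inner ℝ n ((q : Space d) - p) = h - if q = p then h else 0 := by
      intro q
      split_ifs with hqp
      · simp [hqp]
      · rw [hS q (Finset.mem_erase.2 ⟨fun h => hqp (Subtype.ext h), q.2⟩), sub_zero]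
    conv_lhs => rw [h1, inner_sum]
    simp only [inner_smul_right, h2, mul_sub, Finset.sum_sub_distrib, ← Finset.sum_mul,
      sum_coord_linear, zero_mul, mul_ite, mul_zero, Finset.sum_ite_eq', Finset.mem_univ, if_true]
    ring
  rw [hw, hvol']
  ring

include hd hT hcard in
-- Apply the normal-gradient identity to an edge from a vertex `q` of the side to `p`. The
-- coordinate of `p` grows by one along it, so zero area would force zero volume.
theorem area_erase_pos (p : T) : 0 < area (T.erase (p : Space d)) := by
  refine lt_of_le_of_ne measureReal_nonneg fun h => ?_
  have h1 := area_mul_inner_outwardNormal hd hT hcard p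
    ((p : Space d) - (erase_nonempty hd hcard p).choose)
  have hq := (erase_nonempty hd hcard p).choose_spec
  set q := (erase_nonempty hd hcard p).choose
  rw [← h, zero_mul] at h1
  have hqT := Finset.mem_of_mem_erase hq
  have hqp : p ≠ ⟨q, hqT⟩ := fun h => (Finset.ne_of_mem_erase hq) (congrArg Subtype.val h).symm
  have h2 : ((vertexBasis hT hcard).coord p).linear ((p : Space d) - q) = 1 := by
    rw [← vsub_eq_sub, AffineMap.linearMap_vsub]
    have e1 : (p : Space d) = vertexBasis hT hcard p := rfl
    have e2 : q = vertexBasis hT hcard ⟨q, hqT⟩ := rfl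
    rw [e1, e2, AffineBasis.coord_apply_eq, AffineBasis.coord_apply_ne _ hqp]
    simp
  rw [h2] at h1
  have := volume_body_pos hT hcard
  have hd0 : (0 : ℝ) < d := by positivity
  nlinarith [mul_pos hd0 this]

include hd in
theorem coord_bary_erase (p q : T) :
    (vertexBasis hT hcard).coord p (bary (T.erase (q : Space d))) =
      if p = q then 0 else (d : ℝ)⁻¹ := by
  have : ∀ q : T, (vertexBasis hT hcard).coord p q = if p = q then 1 else 0 := fun q =>
    (vertexBasis hT hcard).coord_apply p q
  -- Adding the term of the removed vertex `q` to both sides turns the sum over the side into a sum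
  -- over all vertices.
  rw [affineMap_bary (erase_nonempty hd hcard q), card_erase hcard,
    ← add_right_cancel_iff (a := (d : ℝ)⁻¹ • (vertexBasis hT hcard).coord p q), ← smul_add,
    Finset.sum_erase_add _ _ q.2, ← Finset.sum_coe_sort T]
  simp only [this, Finset.sum_ite_eq, Finset.mem_univ, if_true]
  split_ifs <;> simp

include hd hcard in
theorem affineMap_bary_erase {F : Type*} [AddCommGroup F] [Module ℝ F] (f : Space d →ᵃ[ℝ] F)
    (p : T) : f (bary (T.erase (p : Space d))) = (d : ℝ)⁻¹ • (∑ q : T, f q - f p) := by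
  rw [affineMap_bary (erase_nonempty hd hcard p), card_erase hcard, Finset.sum_coe_sort T,
    ← Finset.sum_erase_eq_sub p.2]

section RaviartThomas

variable {y : Space d →ᵃ[ℝ] Space d} {c : T → ℝ}
  (hy : ∀ p : T, ∀ x ∈ T.erase (p : Space d),
    inner ℝ (y x) (outwardNormal T (T.erase (p : Space d))) = c p)

include hd hy in
/-- The barycentric components of the vertex values of a vector field with constant normal
components on the sides of a simplex. -/
theorem coord_linear_of_normal_const :
    ∃ γ : T → ℝ, (∀ p : T, area (T.erase (p : Space d)) * c p =
        -(d * volume.real (body T)) * γ p) ∧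
      (∀ p q : T, ((vertexBasis hT hcard).coord p).linear (y q) =
        γ p - if p = q then ∑ r, γ r else 0) ∧
      (∀ p : T, ((vertexBasis hT hcard).coord p).linear (y (bary T)) =
        γ p - ((d : ℝ) + 1)⁻¹ * ∑ r, γ r) ∧
      LinearMap.trace ℝ (Space d) y.linear = -d * ∑ r, γ r := by
  have hV := volume_body_pos hT hcard
  have hd0 : (0 : ℝ) < d := by positivity
  set κ := (d : ℝ) * volume.real (body T) with hκ
  have hκ0 : κ ≠ 0 := (mul_pos hd0 hV).ne'
  set b := vertexBasis hT hcard
  refine ⟨fun p => -(area (T.erase (p : Space d)) * c p) / κ, fun p => by field_simp, ?_⟩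
  set γ : T → ℝ := fun p => -(area (T.erase (p : Space d)) * c p) / κ with hγ
  -- Every vertex `q ≠ p` lies on the side opposite `p`, so these values see the same constant
  -- normal component.
  have hne : ∀ p q : T, p ≠ q → (b.coord p).linear (y q) = γ p := by
    intro p q hpq
    have h1 := area_mul_inner_outwardNormal hd hT hcard p (y q)
    rw [real_inner_comm, hy p q (Finset.mem_erase.2 ⟨fun h => hpq (Subtype.ext h.symm), q.2⟩)] at h1
    rw [hγ]
    simp only
    rw [h1]
    field_simp
    rw [mul_comm]
  -- The diagonal entries follow because the linear parts of the coordinates add up to zero.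
  have hγ : ∀ p q : T, (b.coord p).linear (y q) = γ p - if p = q then ∑ r, γ r else 0 := by
    intro p q
    split_ifs with hpq
    · subst hpq
      have h0 := sum_coord_linear b (y p)
      rw [← Finset.add_sum_erase _ _ (Finset.mem_univ p)] at h0
      rw [← Finset.add_sum_erase _ _ (Finset.mem_univ p)]
      rw [Finset.sum_congr rfl fun r hr => hne r p (Finset.ne_of_mem_erase hr)] at h0
      linarith
    · rw [hne p q hpq, sub_zero]
  set Γ := ∑ r, γ r with hΓ
  refine ⟨hγ, ?_, ?_⟩
  · intro p
    rw [affineMap_bary (Finset.card_pos.1 (by omega)), hcard, ← Finset.sum_coe_sort T, map_smul,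
      map_sum]
    simp only [hγ, Finset.sum_sub_distrib, Finset.sum_const, Finset.card_univ, Fintype.card_coe,
      hcard, nsmul_eq_mul, Finset.sum_ite_eq, Finset.mem_univ, if_true, smul_eq_mul]
    have : (d : ℝ) + 1 ≠ 0 := by positivity
    push_cast
    field_simp
  · rw [trace_linear_eq_sum b]
    have : ∀ p : T, (b.coord p).linear (y (b p)) = γ p - Γ := fun p => by
      have := hγ p p
      rwa [if_pos rfl] at this
    simp only [this, Finset.sum_sub_distrib, ← hΓ, Finset.sum_const, Finset.card_univ,
      Fintype.card_coe, hcard, nsmul_eq_mul]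
    push_cast
    ring

include hd hT hcard hy in
/-- Integration by parts on a simplex, for lowest order Raviart--Thomas vector fields and affine
functions. -/
theorem sum_area_mul_eq (v : Space d →ᵃ[ℝ] ℝ) :
    ∑ p : T, area (T.erase (p : Space d)) * (c p * v (bary (T.erase (p : Space d)))) =
      volume.real (body T) *
        (v.linear (y (bary T)) + LinearMap.trace ℝ (Space d) y.linear * v (bary T)) := by
  obtain ⟨γ, hγc, hγ, hyb, htrace⟩ := coord_linear_of_normal_const hd hT hcard hy
  have hd0 : (d : ℝ) ≠ 0 := by positivity
  set b := vertexBasis hT hcard with hb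
  set V := volume.real (body T)
  set Γ := ∑ r, γ r with hΓ
  set W := ∑ q : T, v q with hW
  have hTne : T.Nonempty := Finset.card_pos.1 (by omega)
  have hvb : v (bary T) = ((d : ℝ) + 1)⁻¹ * W := by
    rw [affineMap_bary hTne, hcard, ← Finset.sum_coe_sort T]
    simp [hW]
  have hvl : v.linear (y (bary T)) = ∑ p, γ p * v p - ((d : ℝ) + 1)⁻¹ * Γ * W := by
    rw [linear_eq_sum b v]
    simp only [hyb, smul_eq_mul, sub_mul, Finset.sum_sub_distrib, ← Finset.mul_sum]
    rfl
  have hlhs : ∀ p : T, area (T.erase (p : Space d)) * (c p * v (bary (T.erase (p : Space d)))) =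
      -V * (γ p * W - γ p * v p) := by
    intro p
    rw [← mul_assoc, hγc, affineMap_bary_erase hd hcard, smul_eq_mul]
    field_simp
    rfl
  rw [Finset.sum_congr rfl fun p _ => hlhs p, ← Finset.mul_sum, Finset.sum_sub_distrib,
    ← Finset.sum_mul, htrace, hvl, hvb]
  have : (d : ℝ) + 1 ≠ 0 := by positivity
  field_simp
  ring

include hd hT hcard hy in
/-- A lowest order Raviart--Thomas vector field is determined by its average and divergence. -/
theorem eq_zero_of_bary_of_trace (hb0 : y (bary T) = 0)
    (htr : LinearMap.trace ℝ (Space d) y.linear = 0) : y = 0 := by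
  obtain ⟨γ, hγc, hγ, hyb, htrace⟩ := coord_linear_of_normal_const hd hT hcard hy
  have hd0 : (d : ℝ) ≠ 0 := by positivity
  set b := vertexBasis hT hcard with hb
  set Γ := ∑ r, γ r with hΓ
  have hΓ0 : Γ = 0 := by
    rw [htrace] at htr
    simpa [hd0] using htr
  -- The trace kills the sum of all `γ`, and the value at the barycenter then kills each one.
  have hγ0 : ∀ p, γ p = 0 := by
    intro p
    simpa [hb0, hΓ0] using (hyb p).symm
  have hyq : ∀ q : T, y (b q) = 0 := by
    intro q
    rw [← sum_coord_linear_smul b (y (b q))]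
    refine Finset.sum_eq_zero fun p _ => ?_
    have := hγ p q
    rw [hγ0, hΓ0, ite_self, sub_zero] at this
    rw [show (b.coord p).linear (y (b q)) = 0 from this, zero_smul]
  ext1 x
  rw [affineMap_eq_sum b y x]
  simp [hyq]

end RaviartThomas

end Cell

/-! ### Simplices near their sides. -/

theorem IsOutwardUnitNormal.inner_sub_eq_zero {d : ℕ} {T S : Finset (Space d)} {n : Space d}
    (hn : IsOutwardUnitNormal T S n) {x x' : Space d} (hx : x ∈ body S) (hx' : x' ∈ body S) :
    inner ℝ n (x - x') = 0 := by
  have key : ∀ a : ℝ, (∀ q ∈ S, inner ℝ n q = a) → ∀ x ∈ body S, inner ℝ n x = a := by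
    intro a ha x hx
    exact convexHull_min (fun q hq => ha q hq)
      (convex_hyperplane (innerₗ (Space d) n).isLinear a) hx
  have hS : S.Nonempty := by
    rcases S.eq_empty_or_nonempty with rfl | h
    · simp [body] at hx
    · exact h
  obtain ⟨q₀, hq₀⟩ := hS
  have h := key (inner ℝ n q₀) fun q hq => by
    have := hn.2.1 q₀ hq₀ q hq
    rw [inner_sub_right] at this
    linarith
  rw [inner_sub_right, h x hx, h x' hx', sub_self]

section Cell

variable {d : ℕ} {T : Finset (Space d)} (hd : 1 ≤ d)
  (hT : AffineIndependent ℝ ((↑) : T → Space d)) (hcard : T.card = d + 1)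

theorem mem_body_iff (x : Space d) :
    x ∈ body T ↔ ∀ q, 0 ≤ (vertexBasis hT hcard).coord q x := by
  have := (vertexBasis hT hcard).convexHull_eq_nonneg_coord
  rw [range_vertexBasis] at this
  rw [body, this]
  rfl

theorem coord_erase_eq_zero (p : T) {x : Space d} (hx : x ∈ body (T.erase (p : Space d))) :
    (vertexBasis hT hcard).coord p x = 0 := by
  have hconv : Convex ℝ {x : Space d | (vertexBasis hT hcard).coord p x = 0} :=
    (convex_singleton (0 : ℝ)).affine_preimage ((vertexBasis hT hcard).coord p)
  refine convexHull_min (fun q hq => ?_) hconv hx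
  have hq' : q ∈ T.erase (p : Space d) := hq
  rw [Finset.mem_erase] at hq'
  exact (vertexBasis hT hcard).coord_apply_ne (i := p) (j := ⟨q, hq'.2⟩)
    fun h => hq'.1 (congrArg Subtype.val h).symm

include hd in
/-- Near a relative interior point of a side, the simplex is a half space. -/
theorem eventually_mem_body (p : T) {x : Space d}
    (hxp : (vertexBasis hT hcard).coord p x = 0)
    (hx : ∀ q, q ≠ p → 0 < (vertexBasis hT hcard).coord q x) :
    ∀ᶠ x' in 𝓝 x, inner ℝ (outwardNormal T (T.erase (p : Space d))) (x' - x) ≤ 0 →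
      x' ∈ body T := by
  set b := vertexBasis hT hcard
  have h : ∀ᶠ x' in 𝓝 x, ∀ q, q ≠ p → 0 < b.coord q x' := by
    rw [Filter.eventually_all]
    intro q
    by_cases hq : q = p
    · simp [hq]
    · filter_upwards [(continuous_barycentric_coord b q).continuousAt.eventually
        (lt_mem_nhds (hx q hq))] with x' hx' _ using hx'
  filter_upwards [h] with x' hx' hle
  rw [mem_body_iff hT hcard]
  intro q
  by_cases hq : q = p
  · subst hq
    -- By continuity only the coordinate opposite the side can become negative, and its sign is
    -- opposite to that of the normal displacement.
    have h1 := area_mul_inner_outwardNormal hd hT hcard q (x' - x)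
    rw [← vsub_eq_sub x' x, AffineMap.linearMap_vsub, hxp, vsub_eq_sub, vsub_eq_sub, sub_zero] at h1
    have h2 := area_erase_pos hd hT hcard q
    have h3 := mul_nonpos_of_nonneg_of_nonpos h2.le hle
    have h4 := volume_body_pos hT hcard
    have hd0 : (0 : ℝ) < d := by positivity
    rw [h1] at h3
    by_contra hneg
    push Not at hneg
    nlinarith [mul_pos hd0 h4]
  · exact (hx' q hq).le

end Cell

/-! ### Mesh geometry: interior and boundary sides. -/

namespace Triangulation

variable {d : ℕ} {Ω : Set (Space d)} (M : Triangulation Ω)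

theorem cells_spec (T : M.cells) : T.1 ∈ M.complex.faces ∧ T.1.card = d + 1 := by
  have := T.2
  simpa [cells] using this

theorem sides_spec (S : M.sides) : S.1 ∈ M.complex.faces ∧ S.1.card = d := by
  have := S.2
  simpa [sides] using this

theorem cell_card (T : M.cells) : T.1.card = d + 1 := (M.cells_spec T).2

theorem cell_indep (T : M.cells) : AffineIndependent ℝ ((↑) : T.1 → Space d) :=
  M.complex.indep (M.cells_spec T).1

theorem side_card (S : M.sides) : S.1.card = d := (M.sides_spec S).2

theorem side_indep (S : M.sides) : AffineIndependent ℝ ((↑) : S.1 → Space d) :=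
  M.complex.indep (M.sides_spec S).1

theorem side_nonempty (S : M.sides) : S.1.Nonempty :=
  M.complex.nonempty_of_mem_faces (M.sides_spec S).1

/-- The side of the element `T` opposite to its vertex `p`. -/
def oppositeSide (hd : 1 ≤ d) (T : M.cells) (p : T.1) : M.sides :=
  ⟨T.1.erase p, by
    have h1 : T.1.erase (p : Space d) ∈ M.complex.faces :=
      M.complex.down_closed (M.cells_spec T).1 (Finset.erase_subset _ _)
        (erase_nonempty hd (M.cell_card T) p)
    simp [sides, h1, card_erase (M.cell_card T) p]⟩

theorem oppositeSide_subset (hd : 1 ≤ d) (T : M.cells) (p : T.1) :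
    (M.oppositeSide hd T p).1 ⊆ T.1 := Finset.erase_subset _ _

theorem exists_eq_erase {T : M.cells} {S : M.sides} (h : S.1 ⊆ T.1) :
    ∃ p : T.1, S.1 = T.1.erase (p : Space d) := by
  obtain ⟨p, hp⟩ : ∃ p, T.1 \ S.1 = {p} := by
    rw [← Finset.card_eq_one, Finset.card_sdiff_of_subset h, M.cell_card, M.side_card]; omega
  have hpT : p ∈ T.1 \ S.1 := by rw [hp]; simp
  refine ⟨⟨p, (Finset.mem_sdiff.1 hpT).1⟩, ?_⟩
  rw [Finset.erase_eq, ← hp, Finset.sdiff_sdiff_eq_self h]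

theorem isOutwardUnitNormal {T : M.cells} {S : M.sides} (h : S.1 ⊆ T.1) :
    IsOutwardUnitNormal T.1 S.1 (outwardNormal T.1 S.1) :=
  isOutwardUnitNormal_outwardNormal (M.cell_indep T) h (M.side_nonempty S)
    (by rw [M.cell_card, M.side_card])

theorem area_pos (hd : 1 ≤ d) (S : M.sides) : 0 < area S.1 := by
  obtain ⟨T, hT⟩ := M.exists_cell S
  obtain ⟨p, hp⟩ := M.exists_eq_erase hT
  rw [hp]
  exact area_erase_pos hd (M.cell_indep T) (M.cell_card T) p

theorem body_cell_subset (T : M.cells) : body T.1 ⊆ closure Ω := by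
  rw [← M.space_eq]
  exact M.complex.convexHull_subset_space (M.cells_spec T).1

theorem exists_mem_cell {x : Space d} (hx : x ∈ closure Ω) : ∃ T : M.cells, x ∈ body T.1 := by
  rw [← M.space_eq, M.complex.mem_space_iff] at hx
  obtain ⟨s, hs, hx⟩ := hx
  obtain ⟨T, hT, hsT, hc⟩ := M.pure s hs
  exact ⟨⟨T, by simp [cells, hT, hc]⟩, convexHull_mono (by exact_mod_cast hsT) hx⟩

/-- One more common vertex would make the two `(d + 1)`-element vertex sets equal. -/
theorem inter_eq_side {S : M.sides} {T T' : M.cells} (hne : T ≠ T') (hST : S.1 ⊆ T.1)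
    (hST' : S.1 ⊆ T'.1) : (T.1 : Set (Space d)) ∩ T'.1 = S.1 := by
  classical
  have h : S.1 = T.1 ∩ T'.1 := by
    refine Finset.eq_of_subset_of_card_le (Finset.subset_inter hST hST') ?_
    rw [M.side_card]
    by_contra hlt
    push Not at hlt
    have h1 : T.1 ∩ T'.1 = T.1 := Finset.eq_of_subset_of_card_le Finset.inter_subset_left
      (by rw [M.cell_card]; exact hlt)
    have h2 : T.1 ∩ T'.1 = T'.1 := Finset.eq_of_subset_of_card_le Finset.inter_subset_right
      (by rw [M.cell_card]; exact hlt)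
    exact hne (Subtype.ext (h1.symm.trans h2))
  rw [h]
  simp

theorem eventually_mem_body_bary (hd : 1 ≤ d) {S : M.sides} {T : M.cells} (hST : S.1 ⊆ T.1) :
    ∀ᶠ x in 𝓝 (bary S.1), inner ℝ (outwardNormal T.1 S.1) (x - bary S.1) ≤ 0 → x ∈ body T.1 := by
  obtain ⟨p, hp⟩ := M.exists_eq_erase hST
  rw [hp]
  have hd0 : (0 : ℝ) < d := by positivity
  refine eventually_mem_body hd (M.cell_indep T) (M.cell_card T) p ?_ fun q hq => ?_
  · rw [coord_bary_erase hd]; simp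
  · rw [coord_bary_erase hd, if_neg hq]; positivity

/-- The outward normals of two elements along their common side are opposite. -/
theorem outwardNormal_eq_neg (hd : 1 ≤ d) {S : M.sides} {T T' : M.cells} (hne : T ≠ T')
    (hST : S.1 ⊆ T.1) (hST' : S.1 ⊆ T'.1) :
    outwardNormal T'.1 S.1 = -outwardNormal T.1 S.1 := by
  have hn := M.isOutwardUnitNormal hST
  have hn' := M.isOutwardUnitNormal hST'
  have hev := M.eventually_mem_body_bary hd hST
  have hev' := M.eventually_mem_body_bary hd hST'
  set n := outwardNormal T.1 S.1
  set n' := outwardNormal T'.1 S.1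
  obtain ⟨α, hα⟩ : ∃ α : ℝ, n' = α • n := by
    obtain ⟨p, hp⟩ := M.exists_eq_erase hST
    obtain ⟨s, hs⟩ := M.side_nonempty S
    have hpS : (p : Space d) ∉ S.1 := by rw [hp]; simp
    have hneg := hn.2.2 p p.2 hpS s hs
    -- Both normals annihilate the side. This ratio makes `n' - α • n` also annihilate the one
    -- remaining edge direction, hence everything.
    refine ⟨inner ℝ n' (p - s) / inner ℝ n (p - s), ?_⟩
    set α := inner ℝ n' ((p : Space d) - s) / inner ℝ n (p - s) with hα
    rw [← sub_eq_zero]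
    set b := vertexBasis (M.cell_indep T) (M.cell_card T)
    have hvert : ∀ q : T.1, inner ℝ (n' - α • n) ((q : Space d) - s) = 0 := by
      intro q
      by_cases hq : q = p
      · rw [hq, inner_sub_left, inner_smul_left, hα]
        simp only [conj_trivial]
        rw [div_mul_cancel₀ _ hneg.ne, sub_self]
      · have hqS : (q : Space d) ∈ S.1 := by
          rw [hp, Finset.mem_erase]; exact ⟨fun h => hq (Subtype.ext h), q.2⟩
        rw [inner_sub_left, inner_smul_left, hn.2.1 s hs q hqS, hn'.2.1 s hs q hqS]
        simp
    rw [← inner_self_eq_zero (𝕜 := ℝ)]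
    have h1 : n' - α • n = ∑ q, (b.coord q).linear (n' - α • n) • ((q : Space d) - s) := by
      have := AffineBasisAux.sum_coord_linear_smul b (n' - α • n)
      simp only [smul_sub, Finset.sum_sub_distrib, ← Finset.sum_smul,
        AffineBasisAux.sum_coord_linear, zero_smul, sub_zero]
      exact this.symm
    conv_lhs => rw [h1, inner_sum]
    simp only [← h1]
    refine Finset.sum_eq_zero fun q _ => ?_
    rw [inner_smul_right, hvert, mul_zero]
  have habs : |α| = 1 := by
    have := hn'.1
    rwa [hα, norm_smul, hn.1, mul_one, Real.norm_eq_abs] at this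
  rcases eq_or_eq_neg_of_abs_eq habs with h1 | h1
  -- With equal normals both elements would contain the same half ball at the barycenter. A point
  -- slightly inside would then lie in the common side by conformity, although its normal component
  -- differs.
  · exfalso
    rw [h1, one_smul] at hα
    rw [hα] at hev'
    have hcont : ContinuousAt (fun ε : ℝ => bary S.1 - ε • n) 0 := by fun_prop
    have hten : Filter.Tendsto (fun ε : ℝ => bary S.1 - ε • n) (𝓝 0) (𝓝 (bary S.1)) := by
      simpa [ContinuousAt] using hcont
    have h2 := (hten.eventually (hev.and hev')).filter_mono
      (nhdsWithin_le_nhds (s := Set.Ioi (0 : ℝ)))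
    obtain ⟨ε, ⟨hε1, hε2⟩, hε⟩ := (h2.and self_mem_nhdsWithin).exists
    have hε : 0 < ε := hε
    have hin : inner ℝ n (bary S.1 - ε • n - bary S.1) = -ε := by
      rw [sub_sub_cancel_left, inner_neg_right, inner_smul_right, real_inner_self_eq_norm_sq, hn.1]
      ring
    have hle : inner ℝ n (bary S.1 - ε • n - bary S.1) ≤ 0 := by rw [hin]; linarith
    have hmem := M.complex.inter_subset_convexHull (M.cells_spec T).1 (M.cells_spec T').1
      ⟨hε1 hle, hε2 hle⟩
    rw [M.inter_eq_side hne hST hST'] at hmem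
    have := hn.inner_sub_eq_zero hmem (bary_mem_body (M.side_nonempty S))
    rw [hin] at this
    linarith
  · rw [hα, h1, neg_one_smul]

/-- At most two elements share a side. -/
theorem eq_or_eq_of_subset (hd : 1 ≤ d) {S : M.sides} {T T' T'' : M.cells} (hne : T ≠ T')
    (hST : S.1 ⊆ T.1) (hST' : S.1 ⊆ T'.1) (hST'' : S.1 ⊆ T''.1) : T'' = T ∨ T'' = T' := by
  by_contra h
  push Not at h
  have h1 := M.outwardNormal_eq_neg hd hne hST hST'
  have h2 := M.outwardNormal_eq_neg hd h.1 hST'' hST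
  have h3 := M.outwardNormal_eq_neg hd h.2 hST'' hST'
  -- Three elements would have pairwise opposite normals along `S`, so a unit vector would equal its
  -- own negative.
  have h4 : outwardNormal T.1 S.1 = -outwardNormal T.1 S.1 := by rw [← h1, h3, h2]
  have h5 := (M.isOutwardUnitNormal hST).1
  have h6 : inner ℝ (outwardNormal T.1 S.1) (outwardNormal T.1 S.1) =
      -inner ℝ (outwardNormal T.1 S.1) (outwardNormal T.1 S.1) := by
    nth_rewrite 1 [h4]
    rw [inner_neg_left]
  rw [real_inner_self_eq_norm_sq, h5] at h6
  norm_num at h6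

/-- The half balls inside the two elements fill a neighbourhood of the barycenter of the side. It is
therefore interior to the closure of `Ω`, and `hreg` puts it in `Ω` itself. -/
theorem not_isBoundarySide_of_ne (hd : 1 ≤ d) (hΩ : IsOpen Ω) (hreg : interior (closure Ω) = Ω)
    {S : M.sides} {T T' : M.cells} (hne : T ≠ T') (hST : S.1 ⊆ T.1) (hST' : S.1 ⊆ T'.1) :
    ¬ M.IsBoundarySide S := by
  intro hb
  have hev := M.eventually_mem_body_bary hd hST
  have hev' := M.eventually_mem_body_bary hd hST'
  rw [M.outwardNormal_eq_neg hd hne hST hST'] at hev'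
  have hint : bary S.1 ∈ interior (closure Ω) := by
    rw [mem_interior_iff_mem_nhds]
    filter_upwards [hev, hev'] with x h1 h2
    rcases le_total (inner ℝ (outwardNormal T.1 S.1) (x - bary S.1)) 0 with h | h
    · exact M.body_cell_subset T (h1 h)
    · exact M.body_cell_subset T' (h2 (by rw [inner_neg_left]; linarith))
  rw [hreg] at hint
  have := hb (bary_mem_body (M.side_nonempty S))
  rw [hΩ.frontier_eq] at this
  exact this.2 hint

/-- If a relatively interior point of the side were in `Ω`, a small step along the outward normal
would stay in `Ω` and leave `T`. The element reached contains the starting point, so by conformity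
it contains the whole side. -/
theorem isBoundarySide_of_unique (hd : 1 ≤ d) (hΩ : IsOpen Ω)
    {S : M.sides} {T : M.cells} (hST : S.1 ⊆ T.1) (huniq : ∀ T' : M.cells, S.1 ⊆ T'.1 → T' = T) :
    M.IsBoundarySide S := by
  classical
  obtain ⟨p, hp⟩ := M.exists_eq_erase hST
  have hn := M.isOutwardUnitNormal hST
  set n := outwardNormal T.1 S.1 with hndef
  set b := vertexBasis (M.cell_indep T) (M.cell_card T) with hb
  have hST_body : body S.1 ⊆ body T.1 := convexHull_mono (by exact_mod_cast hST)
  have hd0 : (0 : ℝ) < d := by positivity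
  -- Points with positive coordinates on `S` lie on the boundary.
  have key : ∀ x ∈ body S.1, (∀ q, q ≠ p → 0 < b.coord q x) → x ∈ frontier Ω := by
    intro x hxS hx
    rw [hΩ.frontier_eq]
    refine ⟨M.body_cell_subset T (hST_body hxS), fun hxΩ => ?_⟩
    -- There are finitely many closed elements, so close to `x` only those through `x` can be met.
    have hfar : ∀ᶠ x' in 𝓝 x, ∀ T' : M.cells, x ∉ body T'.1 → x' ∉ body T'.1 := by
      rw [Filter.eventually_all]
      intro T'
      by_cases h : x ∈ body T'.1
      · simp [h]
      · filter_upwards [(isCompact_body T'.1).isClosed.isOpen_compl.mem_nhds h] with x' hx' _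
          using hx'
    have hten : Filter.Tendsto (fun ε : ℝ => x + ε • n) (𝓝 0) (𝓝 x) := by
      have hcont : ContinuousAt (fun ε : ℝ => x + ε • n) 0 := by fun_prop
      simpa [ContinuousAt] using hcont
    have h2 := (hten.eventually (hfar.and (hΩ.mem_nhds hxΩ))).filter_mono
      (nhdsWithin_le_nhds (s := Set.Ioi (0 : ℝ)))
    obtain ⟨ε, ⟨hε1, hε2⟩, hε⟩ := (h2.and self_mem_nhdsWithin).exists
    have hε : 0 < ε := hε
    obtain ⟨T', hT'⟩ := M.exists_mem_cell (subset_closure hε2)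
    have hxT' : x ∈ body T'.1 := by
      by_contra h
      exact hε1 T' h hT'
    have hmem := M.complex.inter_subset_convexHull (M.cells_spec T).1 (M.cells_spec T').1
      ⟨hST_body hxS, hxT'⟩
    -- Conformity puts `x` in the hull of the common vertices. A vertex of `S` outside `T'` would
    -- then have coordinate zero at `x`, contrary to positivity.
    have hsub : S.1 ⊆ T'.1 := by
      intro q hq
      by_contra hqT'
      have hqT : q ∈ T.1 := hST hq
      have hqp : (⟨q, hqT⟩ : T.1) ≠ p := by
        rintro rfl
        rw [hp] at hq
        simp at hq
      have hzero := coord_erase_eq_zero (M.cell_indep T) (M.cell_card T) ⟨q, hqT⟩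
        (x := x) (convexHull_mono (fun r hr => by
          have hr1 : r ∈ T.1 := hr.1
          have hr2 : r ∈ T'.1 := hr.2
          simp only [Finset.coe_erase, Set.mem_sdiff, Set.mem_singleton_iff]
          exact ⟨hr1, fun h => hqT' (h ▸ hr2)⟩) hmem)
      exact (hx _ hqp).ne' hzero
    have hTT' := huniq T' hsub
    subst hTT'
    rw [mem_body_iff (M.cell_indep T') (M.cell_card T')] at hT'
    have h3 := hT' p
    have h4 := area_mul_inner_outwardNormal hd (M.cell_indep T') (M.cell_card T') p (ε • n)
    have h5 : b.coord p (x + ε • n) = (b.coord p).linear (ε • n) := by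
      have := (b.coord p).map_vadd x (ε • n)
      rw [vadd_eq_add, add_comm, vadd_eq_add,
        coord_erase_eq_zero (M.cell_indep T') (M.cell_card T') p (x := x)
          (by rwa [← hp]), add_zero] at this
      exact this
    rw [← hp, ← hndef, inner_smul_right, real_inner_self_eq_norm_sq, hn.1, ← hb, ← h5] at h4
    have h6 := M.area_pos hd S
    have h7 := volume_body_pos (M.cell_indep T') (M.cell_card T')
    have h8 : 0 ≤ d * volume.real (body T'.1) * b.coord p (x + ε • n) := by positivity
    have h9 : 0 < area S.1 * (ε * 1 ^ 2) := by positivity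
    linarith
  intro x hx
  -- Points with vanishing coordinates are reached as limits: moving towards the barycenter makes
  -- the coordinates positive, and the frontier is closed.
  have hten : Filter.Tendsto (fun ε : ℝ => AffineMap.lineMap x (bary S.1) ε) (𝓝[>] 0) (𝓝 x) := by
    have hcont : ContinuousAt (fun ε : ℝ => AffineMap.lineMap x (bary S.1) ε) 0 :=
      AffineMap.lineMap_continuous.continuousAt
    have : Filter.Tendsto (fun ε : ℝ => AffineMap.lineMap x (bary S.1) ε) (𝓝 0) (𝓝 x) := by
      simpa [ContinuousAt] using hcont
    exact this.mono_left nhdsWithin_le_nhds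
  refine isClosed_frontier.mem_of_tendsto hten ?_
  filter_upwards [self_mem_nhdsWithin, nhdsWithin_le_nhds (Iic_mem_nhds one_pos)] with ε hε hε1
  have hε : 0 < ε := hε
  have hε1 : ε ≤ 1 := hε1
  have hbS := bary_mem_body (M.side_nonempty S)
  refine key _ ((convex_convexHull ℝ _).lineMap_mem hx hbS ⟨hε.le, hε1⟩) fun q hq => ?_
  rw [AffineMap.apply_lineMap, AffineMap.lineMap_apply_module]
  have h1 : 0 ≤ b.coord q x := (mem_body_iff (M.cell_indep T) (M.cell_card T) x).1 (hST_body hx) q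
  have h2 : b.coord q (bary S.1) = (d : ℝ)⁻¹ := by
    rw [hp, hb, coord_bary_erase hd, if_neg hq]
  rw [h2]
  have h3 : 0 ≤ 1 - ε := by linarith
  simp only [smul_eq_mul]
  positivity

theorem isInteriorSide_or_isBoundarySide (hd : 1 ≤ d) (hΩ : IsOpen Ω)
    (S : M.sides) : M.IsInteriorSide S ∨ M.IsBoundarySide S := by
  by_cases h : M.IsInteriorSide S
  · exact Or.inl h
  · refine Or.inr (M.isBoundarySide_of_unique hd hΩ (T := M.cellOf S)
      (Classical.choose_spec (M.exists_cell S)) fun T' hT' => ?_)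
    by_contra hne
    exact h ⟨T', M.cellOf S, hne, hT', Classical.choose_spec (M.exists_cell S)⟩

end Triangulation

/-! ### Minimisation of degree-two functionals with a linear load. -/

section Existence

variable {X : Type*} [NormedAddCommGroup X] [NormedSpace ℝ X] [FiniteDimensional ℝ X]
  {Q : X → ℝ} (hQc : Continuous Q) (hQh : ∀ (t : ℝ) x, Q (t • x) = t ^ 2 * Q x)
  (hQp : ∀ x, x ≠ 0 → 0 < Q x)

include hQc hQh hQp in
-- The constant is the minimum over the compact unit sphere, and homogeneity extends it to all
-- vectors. The trivial space has an empty sphere and is treated apart.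
theorem exists_pos_mul_norm_sq_le : ∃ c : ℝ, 0 < c ∧ ∀ x, c * ‖x‖ ^ 2 ≤ Q x := by
  have hQ0 : Q 0 = 0 := by simpa using hQh 0 0
  rcases subsingleton_or_nontrivial X with h | h
  · exact ⟨1, one_pos, fun x => by rw [Subsingleton.elim x 0, hQ0]; simp⟩
  · have hne : (Metric.sphere (0 : X) 1).Nonempty := NormedSpace.sphere_nonempty.2 zero_le_one
    obtain ⟨x₀, hx₀, hmin⟩ := (isCompact_sphere (0 : X) 1).exists_isMinOn hne hQc.continuousOn
    have hx₀1 : ‖x₀‖ = 1 := by simpa using hx₀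
    refine ⟨Q x₀, hQp x₀ (by rintro rfl; simp at hx₀1), fun x => ?_⟩
    rcases eq_or_ne x 0 with rfl | hx
    · simp [hQ0]
    have hxn : ‖x‖ ≠ 0 := norm_ne_zero_iff.2 hx
    have h1 : Q x₀ ≤ Q (‖x‖⁻¹ • x) := hmin (by simp [norm_smul, hxn])
    have h2 : Q x = ‖x‖ ^ 2 * Q (‖x‖⁻¹ • x) := by
      rw [← hQh, smul_smul, mul_inv_cancel₀ hxn, one_smul]
    rw [h2, mul_comm]
    gcongr

include hQc hQh hQp in
/-- A positive definite homogeneous functional of degree two, perturbed by a linear functional,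
attains its minimum on every non-empty closed set. -/
theorem exists_forall_sub_le (l : X →ₗ[ℝ] ℝ) {K : Set X} (hK : IsClosed K) (hne : K.Nonempty) :
    ∃ x ∈ K, ∀ x' ∈ K, Q x - l x ≤ Q x' - l x' := by
  obtain ⟨c, hc, hQ⟩ := exists_pos_mul_norm_sq_le hQc hQh hQp
  obtain ⟨x₀, hx₀⟩ := hne
  have hlc : Continuous l := l.continuous_of_finiteDimensional
  set L : X →L[ℝ] ℝ := l.toContinuousLinearMap
  have hlow : ∀ x, ‖x‖ * (c * ‖x‖ + -‖L‖) ≤ Q x - l x := by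
    intro x
    have h1 : l x ≤ ‖L‖ * ‖x‖ := (le_abs_self _).trans (L.le_opNorm x)
    nlinarith [hQ x]
  have hten : Filter.Tendsto (fun x => Q x - l x) (Filter.cocompact X) Filter.atTop := by
    have hr : Filter.Tendsto (fun r : ℝ => r * (c * r + -‖L‖)) Filter.atTop Filter.atTop :=
      Filter.tendsto_id.atTop_mul_atTop₀
        (Filter.tendsto_atTop_add_const_right _ _ (Filter.tendsto_id.const_mul_atTop hc))
    exact Filter.tendsto_atTop_mono hlow (hr.comp (tendsto_norm_cocompact_atTop (E := X)))
  obtain ⟨x, hx, hmin⟩ := (hQc.sub hlc).continuousOn.exists_isMinOn' hK hx₀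
    ((hten.eventually_ge_atTop (Q x₀ - l x₀)).filter_mono inf_le_left)
  exact ⟨x, hx, fun x' hx' => hmin hx'⟩

include hQc hQh hQp in
/-- If `Q ∘ Φ - l` is bounded below on the affine subspace `v + W`, it attains its minimum there. -/
theorem exists_forall_comp_sub_le {E : Type*} [AddCommGroup E] [Module ℝ E] (Φ : E →ₗ[ℝ] X)
    (l : E →ₗ[ℝ] ℝ) (v : E) (W : Submodule ℝ E) (c : ℝ)
    (hbdd : ∀ w ∈ W, c ≤ Q (Φ (v + w)) - l (v + w)) :
    ∃ w ∈ W, ∀ w' ∈ W, Q (Φ (v + w)) - l (v + w) ≤ Q (Φ (v + w')) - l (v + w') := by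
  -- Along a direction invisible to `Φ` the functional is affine, so it is bounded below only if `l`
  -- vanishes there. The multiple chosen below brings it to `c - 1`.
  have hker : ∀ w ∈ W, Φ w = 0 → l w = 0 := by
    intro w hw hΦ
    by_contra hl
    have h := hbdd (((Q (Φ v) - l v - c + 1) / l w) • w) (W.smul_mem _ hw)
    rw [map_add, map_smul, hΦ, smul_zero, add_zero, map_add, map_smul, smul_eq_mul,
      div_mul_cancel₀ _ hl] at h
    linarith
  -- On `W` the load thus factors through `Φ`, which moves the problem to the finite-dimensional
  -- space `X`, where `Q` is coercive. The values of `l` and `l'` at the base point only shift it by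
  -- a constant.
  obtain ⟨l', hl'⟩ : ∃ l' : X →ₗ[ℝ] ℝ, ∀ w ∈ W, l' (Φ w) = l w := by
    have hmem : l.domRestrict W ∈ (Φ.domRestrict W).ker.dualAnnihilator := by
      rw [Submodule.mem_dualAnnihilator]
      intro w hw
      exact hker w w.2 hw
    rw [← LinearMap.range_dualMap_eq_dualAnnihilator_ker] at hmem
    obtain ⟨l', hl'⟩ := hmem
    exact ⟨l', fun w hw => LinearMap.congr_fun hl' ⟨w, hw⟩⟩
  set K : Set X := (fun x => Φ v + x) '' (W.map Φ : Set X)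
  have hK : IsClosed K :=
    (Homeomorph.addLeft (Φ v)).isClosedMap _ (Submodule.closed_of_finiteDimensional (W.map Φ))
  obtain ⟨x, ⟨_, ⟨w, hw, rfl⟩, rfl⟩, hmin⟩ := exists_forall_sub_le hQc hQh hQp l' hK
    ⟨_, 0, (W.map Φ).zero_mem, rfl⟩
  refine ⟨w, hw, fun w' hw' => ?_⟩
  have h := hmin _ ⟨_, ⟨w', hw', rfl⟩, rfl⟩
  simp only [map_add, hl' w hw, hl' w' hw'] at h ⊢
  linarith

end Existence

/-- A linear functional below a convex increment is controlled at first order: if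
`t * L ≤ t * D + t ^ 2 * K` for all `t ∈ (0, 1]`, then `L ≤ D`. -/
theorem le_of_forall_mul_le {L D K : ℝ} (h : ∀ t : ℝ, 0 < t → t ≤ 1 → t * L ≤ t * D + t ^ 2 * K) :
    L ≤ D := by
  have h' : ∀ t : ℝ, 0 < t → t ≤ 1 → L ≤ D + t * K := by
    intro t ht ht1
    have := h t ht ht1
    have h2 : t * L ≤ t * (D + t * K) := by linarith [this, sq t, mul_assoc t t K]
    exact le_of_mul_le_mul_left h2 ht
  have hten : Filter.Tendsto (fun t : ℝ => D + t * K) (𝓝[>] 0) (𝓝 D) := by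
    have hc : ContinuousAt (fun t : ℝ => D + t * K) 0 := by fun_prop
    have : Filter.Tendsto (fun t : ℝ => D + t * K) (𝓝 0) (𝓝 D) := by
      simpa [ContinuousAt] using hc
    exact this.mono_left nhdsWithin_le_nhds
  refine ge_of_tendsto hten ?_
  filter_upwards [self_mem_nhdsWithin, nhdsWithin_le_nhds (Iic_mem_nhds one_pos)] with t ht ht1
  exact h' t ht ht1

/-! ### Conjugacy of squared weighted `ℓ¹` and maximum norms. -/

section WeightedL1

variable {ι : Type*} [Fintype ι] {m : ℝ} (hm : 0 < m) {a : ι → ℝ} (ha : ∀ i, 0 < a i)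

include hm ha in
/-- The Fenchel--Young inequality for the squared weighted `ℓ¹`-norm. -/
theorem fenchel_young_nonneg {s : ℝ} {lam x : ι → ℝ} (hs : ∀ i, |lam i| ≤ s) :
    0 ≤ 1 / (2 * m) * (∑ i, a i * |x i|) ^ 2 + m / 2 * s ^ 2 + ∑ i, a i * (lam i * x i) := by
  set q := ∑ i, a i * |x i| with hq
  have h1 : -(s * q) ≤ ∑ i, a i * (lam i * x i) := by
    rw [hq, Finset.mul_sum, ← Finset.sum_neg_distrib]
    refine Finset.sum_le_sum fun i _ => ?_
    have h2 : -(s * |x i|) ≤ lam i * x i := by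
      have h3 := neg_abs_le (lam i * x i)
      rw [abs_mul] at h3
      have := mul_le_mul_of_nonneg_right (hs i) (abs_nonneg (x i))
      linarith
    nlinarith [ha i]
  -- Hölder bounds the pairing below by `-(s * q)`; the rest is a complete square.
  have h2 : 1 / (2 * m) * q ^ 2 + m / 2 * s ^ 2 - s * q = 1 / (2 * m) * (q - m * s) ^ 2 := by
    field_simp
    ring
  have h3 : 0 ≤ 1 / (2 * m) * (q - m * s) ^ 2 := by positivity
  linarith

include hm ha in
/-- Equality in the Fenchel--Young inequality for subgradients of the squared weighted
`ℓ¹`-norm. -/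
theorem fenchel_young_le_of_subgradient {s : ℝ} {lam x : ι → ℝ}
    (hs : s = 0 ∨ ∃ i, s = |lam i|)
    (hsub : ∀ x' : ι → ℝ, 1 / (2 * m) * (∑ i, a i * |x i|) ^ 2 + ∑ i, a i * (lam i * (x' i - x i)) ≤
      1 / (2 * m) * (∑ i, a i * |x' i|) ^ 2) :
    1 / (2 * m) * (∑ i, a i * |x i|) ^ 2 + m / 2 * s ^ 2 ≤ ∑ i, a i * (lam i * x i) := by
  classical
  simp only [mul_sub, Finset.sum_sub_distrib] at hsub
  rcases hs with rfl | ⟨j, rfl⟩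
  · have := hsub 0
    simp only [Pi.zero_apply, mul_zero, abs_zero, Finset.sum_const_zero] at this
    norm_num at this ⊢
    linarith
  · have haj := (ha j).ne'
    -- This vector, concentrated where `|lam|` equals `s`, attains the supremum `m / 2 * s ^ 2` in
    -- the definition of the conjugate.
    have := hsub (fun i => if i = j then m * lam j / a j else 0)
    have e1 : ∑ i, a i * |if i = j then m * lam j / a j else 0| = m * |lam j| := by
      rw [Finset.sum_eq_single j]
      · simp only [if_true, abs_div, abs_mul, abs_of_pos hm, abs_of_pos (ha j)]
        field_simp
      · intro i _ hi
        simp [hi]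
      · simp
    have e2 : ∑ i, a i * (lam i * if i = j then m * lam j / a j else 0) = m * lam j ^ 2 := by
      rw [Finset.sum_eq_single j]
      · simp only [if_true]
        field_simp
      · intro i _ hi
        simp [hi]
      · simp
    rw [e1, e2, mul_pow, sq_abs] at this
    rw [sq_abs]
    have e3 : 1 / (2 * m) * (m ^ 2 * lam j ^ 2) = m / 2 * lam j ^ 2 := by field_simp
    rw [e3] at this
    linarith

end WeightedL1

/-! ### Barycentric form of the discrete spaces and integration by parts. -/

namespace Triangulation

variable {d : ℕ} {Ω : Set (Space d)} (M : Triangulation Ω)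

theorem subset_cellOf (S : M.sides) : S.1 ⊆ (M.cellOf S).1 :=
  Classical.choose_spec (M.exists_cell S)

variable {M}

theorem cellAvg_eq (v : M.BrokenP1) (T : M.cells) : cellAvg v T = v T (bary T.1) :=
  setAverage_body (M.cell_indep T) (M.cell_card T) (v T)

theorem cellAvgVec_eq (y : M.BrokenP1Vec) (T : M.cells) : cellAvgVec y T = y T (bary T.1) :=
  setAverage_body (M.cell_indep T) (M.cell_card T) (y T)

theorem average_side (hd : 1 ≤ d) (S : M.sides) (f : Space d →ᵃ[ℝ] ℝ) :
    ⨍ x, f x ∂(surface S.1) = f (bary S.1) :=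
  average_hausdorff_body (M.side_indep S) (by rw [M.side_card]; omega) f

theorem sideAvg_eq (hd : 1 ≤ d) (v : M.BrokenP1) (S : M.sides) :
    sideAvg v S = v (M.cellOf S) (bary S.1) :=
  average_side hd S _

/-- The jump is affine, so its average over a side is its value at the barycenter. -/
theorem mem_CR_iff (hd : 1 ≤ d) (v : M.BrokenP1) :
    v ∈ M.CR ↔ ∀ (S : M.sides) (T T' : M.cells), S.1 ⊆ T.1 → S.1 ⊆ T'.1 →
      v T (bary S.1) = v T' (bary S.1) := by
  have h : ∀ (S : M.sides) (T T' : M.cells),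
      ⨍ x, (v T x - v T' x) ∂(surface S.1) = v T (bary S.1) - v T' (bary S.1) := fun S T T' =>
    average_side hd S (v T - v T')
  constructor
  · intro hv S T T' hT hT'
    by_cases hne : T = T'
    · rw [hne]
    have := hv S ⟨T, T', hne, hT, hT'⟩ T T' hne hT hT'
    rw [h] at this
    linarith
  · intro hv S _ T T' _ hT hT'
    rw [h, hv S T T' hT hT', sub_self]

theorem integral_const_eq (φ : M.cells → ℝ) :
    integral (fun T _ => φ T) = ∑ T : M.cells, volume.real (body T.1) * φ T := by
  simp [integral]

theorem integral_surface_const (S : M.sides) (c : ℝ) :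
    ∫ _, c ∂(surface S.1) = area S.1 * c := by
  simp [area]

theorem surfaceIntegral_const_eq (Γ : Set (Space d)) (φ : M.sidesIn Γ → ℝ) :
    surfaceIntegral Γ (fun S _ => φ S) = ∑ S : M.sidesIn Γ, area S.1.1 * φ S := by
  simp only [surfaceIntegral, integral_surface_const]

/-- The normal component of `y` on the side `S`, as seen from the element `T`. -/
def flux (y : M.BrokenP1Vec) (T : M.cells) (S : M.sides) : ℝ :=
  inner ℝ (y T (bary S.1)) (outwardNormal T.1 S.1)

/-- The normal component of the vector field `y` is constant on each side of each element. -/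
def HasConstFlux (y : M.BrokenP1Vec) : Prop :=
  ∀ (T : M.cells) (S : M.sides), S.1 ⊆ T.1 → ∀ x ∈ body S.1,
    inner ℝ (y T x) (outwardNormal T.1 S.1) = flux y T S

theorem mem_RT_iff (y : M.BrokenP1Vec) :
    y ∈ M.RT ↔ HasConstFlux y ∧ ∀ (S : M.sides) (T T' : M.cells), T ≠ T' → S.1 ⊆ T.1 →
      S.1 ⊆ T'.1 → flux y T S + flux y T' S = 0 := by
  constructor
  · rintro ⟨h1, h2⟩
    refine ⟨fun T S hS x hx => ?_, fun S T T' hne hT hT' =>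
      h2 S ⟨T, T', hne, hT, hT'⟩ T T' hne hT hT' _ (bary_mem_body (M.side_nonempty S))⟩
    obtain ⟨c, hc⟩ := h1 T S hS
    rw [hc x hx, flux, hc _ (bary_mem_body (M.side_nonempty S))]
  · rintro ⟨h1, h2⟩
    refine ⟨fun T S hS => ⟨_, h1 T S hS⟩, fun S _ T T' hne hT hT' x hx => ?_⟩
    rw [h1 T S hT x hx, h1 T' S hT' x hx, h2 S T T' hne hT hT']

theorem normalTrace_ae_eq {y : M.BrokenP1Vec} (hy : HasConstFlux y) (S : M.sides) :
    normalTrace y S =ᵐ[surface S.1] fun _ => flux y (M.cellOf S) S := by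
  refine (ae_restrict_iff' (isCompact_body S.1).measurableSet).2
    (Filter.Eventually.of_forall fun x hx => ?_)
  exact hy _ S (M.subset_cellOf S) x hx

theorem surface_ne_zero (hd : 1 ≤ d) (S : M.sides) : surface S.1 ≠ 0 := by
  intro h
  have h1 := M.area_pos hd S
  rw [area, Measure.real, Measure.restrict_eq_zero.1 h] at h1
  simp at h1

/-- The trace is almost everywhere constant and the side has positive measure, so an almost
everywhere condition is a condition on that constant. -/
theorem normalTrace_ae_eq_const_iff (hd : 1 ≤ d) {y : M.BrokenP1Vec} (hy : HasConstFlux y)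
    (S : M.sides) (c : ℝ) :
    (∀ᵐ x ∂(surface S.1), normalTrace y S x = c) ↔ flux y (M.cellOf S) S = c := by
  have h := normalTrace_ae_eq hy S
  have : NeZero (surface S.1) := ⟨surface_ne_zero hd S⟩
  constructor
  · intro h1
    obtain ⟨x, hx1, hx2⟩ := (h.and h1).exists
    rw [← hx2, hx1]
  · rintro rfl
    exact h

theorem surfaceIntegral_normalTrace_mul {y : M.BrokenP1Vec} (hy : HasConstFlux y)
    (Γ : Set (Space d)) (φ : M.sidesIn Γ → ℝ) :
    surfaceIntegral Γ (fun S x => normalTrace y S.1 x * φ S) =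
      ∑ S : M.sidesIn Γ, area S.1.1 * (flux y (M.cellOf S.1) S.1 * φ S) := by
  refine Finset.sum_congr rfl fun S _ => ?_
  rw [← integral_surface_const]
  refine integral_congr_ae ?_
  filter_upwards [normalTrace_ae_eq hy S.1] with x hx
  rw [hx]

theorem eLpNormEssSup_normalTrace (hd : 1 ≤ d) {y : M.BrokenP1Vec} (hy : HasConstFlux y)
    (S : M.sides) :
    eLpNormEssSup (normalTrace y S) (surface S.1) = ‖flux y (M.cellOf S) S‖ₑ := by
  rw [eLpNormEssSup_congr_ae (normalTrace_ae_eq hy S), eLpNormEssSup_const _ (surface_ne_zero hd S)]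

theorem abs_flux_le_surfaceSupNorm (hd : 1 ≤ d) {y : M.BrokenP1Vec} (hy : HasConstFlux y)
    (Γ : Set (Space d)) (S : M.sidesIn Γ) :
    |flux y (M.cellOf S.1) S.1| ≤ surfaceSupNorm Γ fun S => normalTrace y S.1 := by
  have h1 : |flux y (M.cellOf S.1) S.1| = (‖flux y (M.cellOf S.1) S.1‖ₑ).toReal := by simp
  rw [h1, surfaceSupNorm]
  simp only [eLpNormEssSup_normalTrace hd hy]
  refine ENNReal.toReal_mono ?_ (Finset.le_sup (f := fun S : M.sidesIn Γ =>
    ‖flux y (M.cellOf S.1) S.1‖ₑ) (Finset.mem_univ S))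
  refine ((Finset.sup_lt_iff ENNReal.zero_lt_top).2 fun S _ => ?_).ne
  exact enorm_lt_top

/-- A finite supremum is attained; over an empty set of sides it is zero. The alternative is the one
required by `fenchel_young_le_of_subgradient`. -/
theorem surfaceSupNorm_eq (hd : 1 ≤ d) {y : M.BrokenP1Vec} (hy : HasConstFlux y)
    (Γ : Set (Space d)) :
    (surfaceSupNorm Γ fun S : M.sidesIn Γ => normalTrace y S.1) = 0 ∨
      ∃ S : M.sidesIn Γ, (surfaceSupNorm Γ fun S => normalTrace y S.1) =
        |flux y (M.cellOf S.1) S.1| := by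
  rw [surfaceSupNorm]
  simp only [eLpNormEssSup_normalTrace hd hy]
  rcases (Finset.univ : Finset (M.sidesIn Γ)).eq_empty_or_nonempty with h | h
  · left
    rw [h]
    simp
  · right
    obtain ⟨S, -, hS⟩ := Finset.exists_mem_eq_sup Finset.univ h
      fun S : M.sidesIn Γ => ‖flux y (M.cellOf S.1) S.1‖ₑ
    exact ⟨S, by rw [hS]; simp⟩

open Classical in
-- Within an element, vertices correspond bijectively to sides by opposition; afterwards the two
-- summations are exchanged.
theorem sum_oppositeSide (hd : 1 ≤ d) (F : M.cells → M.sides → ℝ) :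
    ∑ T : M.cells, ∑ p : T.1, F T (M.oppositeSide hd T p) =
      ∑ S : M.sides, ∑ T : M.cells with S.1 ⊆ T.1, F T S := by
  simp_rw [Finset.sum_filter]
  rw [Finset.sum_comm]
  refine Finset.sum_congr rfl fun T _ => ?_
  rw [← Finset.sum_filter]
  refine Finset.sum_bij (fun p _ => M.oppositeSide hd T p) ?_ ?_ ?_ ?_
  · intro p _
    simpa using M.oppositeSide_subset hd T p
  · intro p _ q _ h
    have h' : T.1.erase (p : Space d) = T.1.erase (q : Space d) := congrArg Subtype.val h
    exact Subtype.ext (Finset.erase_injOn T.1 p.2 q.2 h')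
  · intro S hS
    obtain ⟨p, hp⟩ := M.exists_eq_erase (T := T) (S := S) (by simpa using hS)
    exact ⟨p, Finset.mem_univ _, Subtype.ext hp.symm⟩
  · intro p _
    rfl

open Classical in
theorem filter_eq_singleton (hd : 1 ≤ d) (hΩ : IsOpen Ω) (hreg : interior (closure Ω) = Ω)
    {S : M.sides} (hS : M.IsBoundarySide S) :
    (Finset.univ.filter fun T : M.cells => S.1 ⊆ T.1) = {M.cellOf S} := by
  ext T
  simp only [Finset.mem_filter, Finset.mem_univ, true_and, Finset.mem_singleton]
  constructor
  · intro h
    by_contra hne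
    exact M.not_isBoundarySide_of_ne hd hΩ hreg hne h (M.subset_cellOf S) hS
  · rintro rfl
    exact M.subset_cellOf S

open Classical in
theorem filter_eq_pair (hd : 1 ≤ d) {S : M.sides} {T T' : M.cells} (hne : T ≠ T')
    (hT : S.1 ⊆ T.1) (hT' : S.1 ⊆ T'.1) :
    (Finset.univ.filter fun T : M.cells => S.1 ⊆ T.1) = {T, T'} := by
  ext T''
  simp only [Finset.mem_filter, Finset.mem_univ, true_and, Finset.mem_insert,
    Finset.mem_singleton]
  constructor
  · exact fun h => M.eq_or_eq_of_subset hd hne hT hT' h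
  · rintro (rfl | rfl) <;> assumption

theorem inner_grad (v : M.BrokenP1) (T : M.cells) (w : Space d) :
    inner ℝ (grad v T) w = (v T).linear w := by
  rw [grad, InnerProductSpace.toDual_symm_apply]
  rfl

open Classical in
/-- Element-wise integration by parts. -/
theorem sum_volume_mul_eq (hd : 1 ≤ d) {y : M.BrokenP1Vec} (hy : HasConstFlux y)
    (v : M.BrokenP1) :
    ∑ T : M.cells, volume.real (body T.1) *
        (inner ℝ (grad v T) (y T (bary T.1)) + div y T * v T (bary T.1)) =
      ∑ S : M.sides, ∑ T : M.cells with S.1 ⊆ T.1,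
        area S.1 * (flux y T S * v T (bary S.1)) := by
  rw [← sum_oppositeSide hd fun T S => area S.1 * (flux y T S * v T (bary S.1))]
  refine Finset.sum_congr rfl fun T _ => ?_
  rw [inner_grad, div, ← sum_area_mul_eq hd (M.cell_indep T) (M.cell_card T)
    (c := fun p => flux y T (M.oppositeSide hd T p))]
  · rfl
  · intro p x hx
    exact hy T (M.oppositeSide hd T p) (M.oppositeSide_subset hd T p) x
      (subset_convexHull ℝ _ hx)

theorem mem_sidesIn (Γ : Set (Space d)) (S : M.sides) :
    S ∈ M.sidesIn Γ ↔ M.IsBoundarySide S ∧ intrinsicInterior ℝ (body S.1) ⊆ Γ := by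
  simp [sidesIn]

/-- The relative interior of a side is non-empty, so it cannot lie in two disjoint boundary parts.
-/
theorem disjoint_sidesIn {Γ Γ' : Set (Space d)} (h : Disjoint Γ Γ') :
    Disjoint (M.sidesIn Γ) (M.sidesIn Γ') := by
  rw [Finset.disjoint_left]
  intro S hS hS'
  rw [mem_sidesIn] at hS hS'
  obtain ⟨x, hx⟩ := Set.Nonempty.intrinsicInterior (convex_convexHull ℝ (S.1 : Set (Space d)))
    ⟨_, bary_mem_body (M.side_nonempty S)⟩
  exact Set.disjoint_left.1 h (hS.2 hx) (hS'.2 hx)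

theorem sum_sides_eq {B : BoundarySplitting Ω} (hMB : M.Resolves B) {G : M.sides → ℝ}
    (hG : ∀ S, ¬ M.IsBoundarySide S → G S = 0) :
    ∑ S, G S = ∑ S : M.sidesIn B.I, G S.1 + ∑ S : M.sidesIn B.D, G S.1 +
      ∑ S : M.sidesIn B.N, G S.1 := by
  classical
  rw [Finset.sum_coe_sort (M.sidesIn B.I), Finset.sum_coe_sort (M.sidesIn B.D),
    Finset.sum_coe_sort (M.sidesIn B.N), ← Finset.sum_union (disjoint_sidesIn B.disjointID),
    ← Finset.sum_union (Finset.disjoint_union_left.2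
      ⟨disjoint_sidesIn B.disjointIN, disjoint_sidesIn B.disjointDN⟩)]
  symm
  refine Finset.sum_subset (Finset.subset_univ _) fun S _ hS => hG S fun hb => hS ?_
  rw [Finset.mem_union, Finset.mem_union, or_assoc]
  exact hMB S hb

/-- Discrete integration by parts for Crouzeix--Raviart functions and Raviart--Thomas vector
fields. -/
theorem discrete_integration_by_parts (hd : 1 ≤ d) (hΩ : IsOpen Ω)
    (hreg : interior (closure Ω) = Ω) {B : BoundarySplitting Ω} (hMB : M.Resolves B)
    {v : M.BrokenP1} (hv : v ∈ M.CR) {y : M.BrokenP1Vec} (hy : y ∈ M.RT) :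
    ∑ T : M.cells, volume.real (body T.1) *
        (inner ℝ (grad v T) (y T (bary T.1)) + div y T * v T (bary T.1)) =
      ∑ S : M.sidesIn B.I, area S.1.1 * (flux y (M.cellOf S.1) S.1 * sideAvg v S.1) +
      ∑ S : M.sidesIn B.D, area S.1.1 * (flux y (M.cellOf S.1) S.1 * sideAvg v S.1) +
      ∑ S : M.sidesIn B.N, area S.1.1 * (flux y (M.cellOf S.1) S.1 * sideAvg v S.1) := by
  classical
  rw [mem_RT_iff] at hy
  rw [mem_CR_iff hd] at hv
  rw [sum_volume_mul_eq hd hy.1, sum_sides_eq hMB]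
  · have key : ∀ Γ, ∀ S : M.sidesIn Γ, ∑ T : M.cells with S.1.1 ⊆ T.1,
        area S.1.1 * (flux y T S.1 * v T (bary S.1.1)) =
          area S.1.1 * (flux y (M.cellOf S.1) S.1 * sideAvg v S.1) := by
      intro Γ S
      rw [filter_eq_singleton hd hΩ hreg ((mem_sidesIn _ _).1 S.2).1, Finset.sum_singleton,
        sideAvg_eq hd]
    simp only [key]
  · intro S hS
    obtain ⟨T, T', hne, hT, hT'⟩ := (M.isInteriorSide_or_isBoundarySide hd hΩ S).resolve_right hS
    -- On an interior side the two function values at the barycenter agree and the two fluxes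
    -- cancel.
    rw [filter_eq_pair hd hne hT hT', Finset.sum_pair hne, hv S T T' hT hT', ← mul_add, ← add_mul,
      hy.2 S T T' hne hT hT', zero_mul, mul_zero]

/-- The Crouzeix--Raviart function with prescribed averages on all sides. -/
def crLift (hd : 1 ≤ d) (w : M.sides → ℝ) : M.BrokenP1 := fun T =>
  ∑ p : T.1, w (M.oppositeSide hd T p) • (AffineMap.const ℝ (Space d) (1 : ℝ) -
    (d : ℝ) • (vertexBasis (M.cell_indep T) (M.cell_card T)).coord p)

theorem crLift_bary (hd : 1 ≤ d) (w : M.sides → ℝ) {S : M.sides} {T : M.cells}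
    (h : S.1 ⊆ T.1) : crLift hd w T (bary S.1) = w S := by
  obtain ⟨p, hp⟩ := M.exists_eq_erase h
  have hS : S = M.oppositeSide hd T p := Subtype.ext hp
  have hd0 : (d : ℝ) ≠ 0 := by positivity
  have happ : ∀ x, crLift hd w T x = ∑ q : T.1, w (M.oppositeSide hd T q) *
      (1 - d * (vertexBasis (M.cell_indep T) (M.cell_card T)).coord q x) := by
    intro x
    let ev : (Space d →ᵃ[ℝ] ℝ) →+ ℝ := ⟨⟨fun f => f x, rfl⟩, fun _ _ => rfl⟩
    exact map_sum ev _ _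
  -- At the barycenter of the side opposite `p`, the coordinate of `p` is `0` and all others are `1
  -- / d`, so `1 - d * coord` is a nodal basis for the side averages.
  rw [happ, Finset.sum_eq_single p]
  · rw [hp, coord_bary_erase hd, if_pos rfl, hS]
    ring
  · intro q _ hq
    rw [hp, coord_bary_erase hd, if_neg hq, mul_inv_cancel₀ hd0]
    ring
  · simp

theorem crLift_mem_CR (hd : 1 ≤ d) (w : M.sides → ℝ) : crLift hd w ∈ M.CR := by
  rw [mem_CR_iff hd]
  intro S T T' hT hT'
  rw [crLift_bary hd w hT, crLift_bary hd w hT']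

theorem sideAvg_crLift (hd : 1 ≤ d) (w : M.sides → ℝ) (S : M.sides) :
    sideAvg (crLift hd w) S = w S := by
  rw [sideAvg_eq hd, crLift_bary hd w (M.subset_cellOf S)]

end Triangulation

open Triangulation

/-! ### Finite energies, the gap identity and weak duality. -/

section Energies

variable {d : ℕ} {Ω : Set (Space d)} (M : Triangulation Ω) (B : BoundarySplitting Ω) (m : ℝ)
  (f : M.cells → ℝ) (g : M.sidesIn B.N → ℝ) (uD : M.sidesIn B.D → ℝ)

/-- The weighted `ℓ¹`-norm of the side averages on the insulated boundary part. -/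
def insulationNorm (v : M.BrokenP1) : ℝ := ∑ S : M.sidesIn B.I, area S.1.1 * |sideAvg v S.1|

/-- The linear part of the discrete primal energy. -/
def load (v : M.BrokenP1) : ℝ :=
  ∑ T : M.cells, volume.real (body T.1) * (f T * v T (bary T.1)) +
    ∑ S : M.sidesIn B.N, area S.1.1 * (g S * sideAvg v S.1)

/-- The finite part of the discrete primal energy. -/
def primalReal (v : M.BrokenP1) : ℝ :=
  1 / 2 * ∑ T : M.cells, volume.real (body T.1) * ‖grad v T‖ ^ 2 +
    1 / (2 * m) * insulationNorm M B v ^ 2 - load M B f g v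

/-- The finite part of the discrete dual energy. -/
def dualReal (y : M.BrokenP1Vec) : ℝ :=
  -(1 / 2) * ∑ T : M.cells, volume.real (body T.1) * ‖y T (bary T.1)‖ ^ 2 -
    m / 2 * (surfaceSupNorm B.I fun S : M.sidesIn B.I => normalTrace y S.1) ^ 2 +
    ∑ S : M.sidesIn B.D, area S.1.1 * (flux y (M.cellOf S.1) S.1 * uD S)

/-- Crouzeix--Raviart functions satisfying the Dirichlet condition. -/
def PrimalAdmissible (v : M.BrokenP1) : Prop :=
  v ∈ M.CR ∧ ∀ S : M.sidesIn B.D, sideAvg v S.1 = uD S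

/-- Raviart--Thomas vector fields satisfying the divergence and the Neumann condition. -/
def DualAdmissible (y : M.BrokenP1Vec) : Prop :=
  y ∈ M.RT ∧ (∀ T : M.cells, div y T = -f T) ∧
    ∀ S : M.sidesIn B.N, flux y (M.cellOf S.1) S.1 = g S

variable {M B m f g uD}

theorem primalEnergy_eq (v : M.BrokenP1) :
    primalEnergy M B m f g uD v = (primalReal M B m f g v : EReal) +
      indicator (∀ S : M.sidesIn B.D, sideAvg v S.1 = uD S) := by
  rw [primalEnergy, integral_const_eq, integral_const_eq, surfaceIntegral_const_eq,
    surfaceIntegral_const_eq]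
  simp only [cellAvg_eq]
  rw [primalReal, load, insulationNorm, sub_sub]

theorem primalEnergy_of_admissible {v : M.BrokenP1} (hv : PrimalAdmissible M B uD v) :
    primalEnergy M B m f g uD v = (primalReal M B m f g v : EReal) := by
  rw [primalEnergy_eq, indicator, if_pos hv.2, add_zero]

theorem mem_primalSet_iff {v : M.BrokenP1} :
    v ∈ primalSet M B m f g uD ↔ PrimalAdmissible M B uD v := by
  refine and_congr_right fun _ => ?_
  rw [primalEnergy_eq, indicator]
  split_ifs with h
  · simp [h]
  · rw [EReal.coe_add_top]
    exact iff_of_false (lt_irrefl _) h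

theorem dualEnergy_eq (hd : 1 ≤ d) {y : M.BrokenP1Vec} (hy : y ∈ M.RT) :
    dualEnergy M B m f g uD y = (dualReal M B m uD y : EReal) -
      indicator (∀ T : M.cells, div y T = -f T) -
      indicator (∀ S : M.sidesIn B.N, flux y (M.cellOf S.1) S.1 = g S) := by
  have hc := ((mem_RT_iff y).1 hy).1
  rw [dualEnergy, integral_const_eq, surfaceIntegral_normalTrace_mul hc, dualReal]
  simp only [cellAvgVec_eq, normalTrace_ae_eq_const_iff hd hc]

theorem dualEnergy_of_admissible (hd : 1 ≤ d) {y : M.BrokenP1Vec}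
    (hy : DualAdmissible M B f g y) :
    dualEnergy M B m f g uD y = (dualReal M B m uD y : EReal) := by
  rw [dualEnergy_eq hd hy.1, indicator, indicator, if_pos hy.2.1, if_pos hy.2.2, sub_zero, sub_zero]

theorem dualEnergy_of_not_admissible (hd : 1 ≤ d) {y : M.BrokenP1Vec} (hy : y ∈ M.RT)
    (hy' : ¬ DualAdmissible M B f g y) : dualEnergy M B m f g uD y = ⊥ := by
  rw [dualEnergy_eq hd hy, indicator, indicator]
  by_cases h1 : ∀ T : M.cells, div y T = -f T
  · have h2 : ¬ ∀ S : M.sidesIn B.N, flux y (M.cellOf S.1) S.1 = g S := fun h2 => hy' ⟨hy, h1, h2⟩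
    rw [if_neg h2, EReal.sub_top]
  · rw [if_neg h1, EReal.sub_top, EReal.bot_sub]

theorem mem_dualSet_iff (hd : 1 ≤ d) {y : M.BrokenP1Vec} :
    y ∈ dualSet M B m f g uD ↔ DualAdmissible M B f g y := by
  constructor
  · rintro ⟨hy, hlt⟩
    by_contra h
    rw [dualEnergy_of_not_admissible hd hy h, EReal.neg_bot] at hlt
    exact lt_irrefl _ hlt
  · intro h
    refine ⟨h.1, ?_⟩
    rw [dualEnergy_of_admissible hd h, ← EReal.coe_neg]
    exact EReal.coe_lt_top _

theorem isPrimalSolution_iff {u : M.BrokenP1} :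
    IsPrimalSolution M B m f g uD u ↔ PrimalAdmissible M B uD u ∧
      ∀ v, PrimalAdmissible M B uD v → primalReal M B m f g u ≤ primalReal M B m f g v := by
  rw [IsPrimalSolution, mem_primalSet_iff]
  refine and_congr_right fun hu => ⟨fun h v hv => ?_, fun h v hv => ?_⟩
  · have := isMinOn_iff.1 h v hv.1
    rwa [primalEnergy_of_admissible hu, primalEnergy_of_admissible hv, EReal.coe_le_coe_iff] at this
  · change primalEnergy M B m f g uD u ≤ primalEnergy M B m f g uD v
    by_cases hD : ∀ S : M.sidesIn B.D, sideAvg v S.1 = uD S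
    · have hv' : PrimalAdmissible M B uD v := ⟨hv, hD⟩
      rw [primalEnergy_of_admissible hu, primalEnergy_of_admissible hv', EReal.coe_le_coe_iff]
      exact h v hv'
    · rw [primalEnergy_eq v, indicator, if_neg hD, EReal.coe_add_top]
      exact le_top

theorem isDualSolution_iff (hd : 1 ≤ d) {z : M.BrokenP1Vec} :
    IsDualSolution M B m f g uD z ↔ DualAdmissible M B f g z ∧
      ∀ y, DualAdmissible M B f g y → dualReal M B m uD y ≤ dualReal M B m uD z := by
  rw [IsDualSolution, mem_dualSet_iff hd]
  refine and_congr_right fun hz => ⟨fun h y hy => ?_, fun h y hy => ?_⟩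
  · have := isMaxOn_iff.1 h y hy.1
    rwa [dualEnergy_of_admissible hd hz, dualEnergy_of_admissible hd hy,
      EReal.coe_le_coe_iff] at this
  · change dualEnergy M B m f g uD y ≤ dualEnergy M B m f g uD z
    by_cases hy' : DualAdmissible M B f g y
    · rw [dualEnergy_of_admissible hd hz, dualEnergy_of_admissible hd hy', EReal.coe_le_coe_iff]
      exact h y hy'
    · rw [dualEnergy_of_not_admissible hd hy hy']
      exact bot_le

/-- The primal-dual gap as a sum of two non-negative contributions. -/
theorem primalReal_sub_dualReal (hd : 1 ≤ d) (hΩ : IsOpen Ω) (hreg : interior (closure Ω) = Ω)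
    (hMB : M.Resolves B) {v : M.BrokenP1} (hv : PrimalAdmissible M B uD v) {y : M.BrokenP1Vec}
    (hy : DualAdmissible M B f g y) :
    primalReal M B m f g v - dualReal M B m uD y =
      1 / 2 * ∑ T : M.cells, volume.real (body T.1) * ‖grad v T - y T (bary T.1)‖ ^ 2 +
      (1 / (2 * m) * insulationNorm M B v ^ 2 +
        m / 2 * (surfaceSupNorm B.I fun S : M.sidesIn B.I => normalTrace y S.1) ^ 2 +
        ∑ S : M.sidesIn B.I, area S.1.1 * (flux y (M.cellOf S.1) S.1 * sideAvg v S.1)) := by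
  have hibp := discrete_integration_by_parts hd hΩ hreg hMB hv.1 hy.1
  -- The constraints on `y` and `v` turn the divergence, Neumann and Dirichlet terms into data,
  -- which cancel against the linear terms of the energies.
  simp only [hy.2.1, hy.2.2, hv.2, mul_add, neg_mul, mul_neg, Finset.sum_add_distrib,
    Finset.sum_neg_distrib] at hibp
  simp only [norm_sub_sq_real, mul_add, mul_sub, Finset.sum_add_distrib, Finset.sum_sub_distrib]
  have h2 : ∑ T : M.cells, volume.real (body T.1) * (2 * inner ℝ (grad v T) (y T (bary T.1))) =
      2 * ∑ T : M.cells, volume.real (body T.1) * inner ℝ (grad v T) (y T (bary T.1)) := by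
    rw [Finset.mul_sum]
    exact Finset.sum_congr rfl fun _ _ => by ring
  rw [h2, primalReal, dualReal, load]
  linarith

theorem insulation_gap_nonneg (hd : 1 ≤ d) (hm : 0 < m) (v : M.BrokenP1) {y : M.BrokenP1Vec}
    (hy : y ∈ M.RT) :
    0 ≤ 1 / (2 * m) * insulationNorm M B v ^ 2 +
        m / 2 * (surfaceSupNorm B.I fun S : M.sidesIn B.I => normalTrace y S.1) ^ 2 +
        ∑ S : M.sidesIn B.I, area S.1.1 * (flux y (M.cellOf S.1) S.1 * sideAvg v S.1) :=
  fenchel_young_nonneg hm (fun S : M.sidesIn B.I => M.area_pos hd S.1)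
    (abs_flux_le_surfaceSupNorm hd ((mem_RT_iff y).1 hy).1 B.I)

theorem dualReal_le_primalReal (hd : 1 ≤ d) (hΩ : IsOpen Ω) (hreg : interior (closure Ω) = Ω)
    (hMB : M.Resolves B) (hm : 0 < m) {v : M.BrokenP1} (hv : PrimalAdmissible M B uD v)
    {y : M.BrokenP1Vec} (hy : DualAdmissible M B f g y) :
    dualReal M B m uD y ≤ primalReal M B m f g v := by
  have h1 := primalReal_sub_dualReal (m := m) hd hΩ hreg hMB hv hy
  have h2 := insulation_gap_nonneg (B := B) hd hm v hy.1
  have h3 : 0 ≤ ∑ T : M.cells, volume.real (body T.1) * ‖grad v T - y T (bary T.1)‖ ^ 2 :=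
    Finset.sum_nonneg fun T _ => by positivity
  linarith

/-- A dual admissible vector field without gap is determined by the primal function. -/
theorem dual_unique_of_no_gap (hd : 1 ≤ d) (hΩ : IsOpen Ω) (hreg : interior (closure Ω) = Ω)
    (hMB : M.Resolves B) (hm : 0 < m) {v : M.BrokenP1} (hv : PrimalAdmissible M B uD v)
    {y z : M.BrokenP1Vec} (hy : DualAdmissible M B f g y) (hz : DualAdmissible M B f g z)
    (hvy : primalReal M B m f g v ≤ dualReal M B m uD y)
    (hvz : primalReal M B m f g v ≤ dualReal M B m uD z) : y = z := by
  have key : ∀ x : M.BrokenP1Vec, DualAdmissible M B f g x →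
      primalReal M B m f g v ≤ dualReal M B m uD x → ∀ T, x T (bary T.1) = grad v T := by
    intro x hx hvx T
    have h1 := primalReal_sub_dualReal (m := m) hd hΩ hreg hMB hv hx
    have h2 := insulation_gap_nonneg (B := B) hd hm v hx.1
    have h3 : ∑ T : M.cells, volume.real (body T.1) * ‖grad v T - x T (bary T.1)‖ ^ 2 = 0 := by
      refine le_antisymm (by linarith) (Finset.sum_nonneg fun T _ => by positivity)
    rw [Finset.sum_eq_zero_iff_of_nonneg fun T _ => by positivity] at h3
    have h4 := (mul_eq_zero.1 (h3 T (Finset.mem_univ T))).resolve_left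
      (volume_body_pos (M.cell_indep T) (M.cell_card T)).ne'
    rw [sq_eq_zero_iff, norm_eq_zero, sub_eq_zero] at h4
    exact h4.symm
  funext T
  rw [← sub_eq_zero]
  have hyc := ((mem_RT_iff y).1 hy.1).1
  have hzc := ((mem_RT_iff z).1 hz.1).1
  -- The difference of the two fields has constant fluxes, zero element averages and zero
  -- divergence.
  refine eq_zero_of_bary_of_trace hd (M.cell_indep T) (M.cell_card T)
    (c := fun p => flux y T (M.oppositeSide hd T p) - flux z T (M.oppositeSide hd T p)) ?_ ?_ ?_
  · intro p x hx
    have hx' : x ∈ body (M.oppositeSide hd T p).1 := subset_convexHull ℝ _ hx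
    have h1 := hyc T _ (M.oppositeSide_subset hd T p) x hx'
    have h2 := hzc T _ (M.oppositeSide_subset hd T p) x hx'
    rw [← h1, ← h2, ← inner_sub_left]
    rfl
  · change y T (bary T.1) - z T (bary T.1) = 0
    rw [key y hy hvy, key z hz hvz, sub_self]
  · have h1 := hy.2.1 T
    rw [← hz.2.1 T] at h1
    rw [AffineMap.sub_linear, map_sub]
    exact sub_eq_zero.2 h1

end Energies

/-! ### Existence of a primal minimiser and its variational inequality. -/

section Linear

variable {d : ℕ} {Ω : Set (Space d)} {M : Triangulation Ω}

theorem grad_add (v w : M.BrokenP1) (T : M.cells) : grad (v + w) T = grad v T + grad w T := by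
  refine ext_inner_right ℝ fun x => ?_
  rw [inner_add_left, inner_grad, inner_grad, inner_grad]
  rfl

theorem grad_smul (t : ℝ) (v : M.BrokenP1) (T : M.cells) : grad (t • v) T = t • grad v T := by
  refine ext_inner_right ℝ fun x => ?_
  rw [inner_smul_left, inner_grad, inner_grad]
  rfl

variable (hd : 1 ≤ d)
include hd

theorem sideAvg_add (v w : M.BrokenP1) (S : M.sides) :
    sideAvg (v + w) S = sideAvg v S + sideAvg w S := by
  simp only [sideAvg_eq hd]
  rfl

theorem sideAvg_smul (t : ℝ) (v : M.BrokenP1) (S : M.sides) :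
    sideAvg (t • v) S = t * sideAvg v S := by
  simp only [sideAvg_eq hd]
  rfl

variable (B : BoundarySplitting Ω) (f : M.cells → ℝ) (g : M.sidesIn B.N → ℝ)

theorem load_add (v w : M.BrokenP1) :
    load M B f g (v + w) = load M B f g v + load M B f g w := by
  simp only [load, sideAvg_add hd, Pi.add_apply, AffineMap.coe_add, mul_add,
    Finset.sum_add_distrib]
  ring

theorem load_smul (t : ℝ) (v : M.BrokenP1) : load M B f g (t • v) = t * load M B f g v := by
  simp only [load, sideAvg_smul hd, Pi.smul_apply, AffineMap.coe_smul, smul_eq_mul, mul_add,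
    Finset.mul_sum]
  congr 1 <;> exact Finset.sum_congr rfl fun _ _ => by ring

theorem add_mem_CR {v w : M.BrokenP1} (hv : v ∈ M.CR) (hw : w ∈ M.CR) : v + w ∈ M.CR := by
  rw [mem_CR_iff hd] at *
  intro S T T' hT hT'
  simp only [Pi.add_apply, AffineMap.coe_add, hv S T T' hT hT', hw S T T' hT hT']

theorem smul_mem_CR (t : ℝ) {v : M.BrokenP1} (hv : v ∈ M.CR) : t • v ∈ M.CR := by
  rw [mem_CR_iff hd] at *
  intro S T T' hT hT'
  simp only [Pi.smul_apply, AffineMap.coe_smul, hv S T T' hT hT']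

/-- The discrete primal problem has a solution if the energy is bounded below. -/
theorem exists_primalReal_min {m : ℝ} (hm : 0 < m) {uD : M.sidesIn B.D → ℝ} {v : M.BrokenP1}
    (hv : PrimalAdmissible M B uD v) {c : ℝ}
    (hc : ∀ w, PrimalAdmissible M B uD w → c ≤ primalReal M B m f g w) :
    ∃ u, PrimalAdmissible M B uD u ∧
      ∀ w, PrimalAdmissible M B uD w → primalReal M B m f g u ≤ primalReal M B m f g w := by
  let Q : (M.cells → Space d) × (M.sidesIn B.I → ℝ) → ℝ := fun x => 1 / 2 * ∑ T : M.cells, volume.real (body T.1) * ‖x.1 T‖ ^ 2 +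
    1 / (2 * m) * (∑ S : M.sidesIn B.I, area S.1.1 * |x.2 S|) ^ 2
  have hQ : ∀ x, Q x = 1 / 2 * ∑ T : M.cells, volume.real (body T.1) * ‖x.1 T‖ ^ 2 +
    1 / (2 * m) * (∑ S : M.sidesIn B.I, area S.1.1 * |x.2 S|) ^ 2 := fun x => rfl
  have hQc : Continuous Q := by
    simp only [Q]
    fun_prop
  have hQh : ∀ (t : ℝ) x, Q (t • x) = t ^ 2 * Q x := by
    intro t x
    have e1 : ∑ T : M.cells, volume.real (body T.1) * ‖(t • x).1 T‖ ^ 2 =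
        t ^ 2 * ∑ T : M.cells, volume.real (body T.1) * ‖x.1 T‖ ^ 2 := by
      rw [Finset.mul_sum]
      refine Finset.sum_congr rfl fun T _ => ?_
      rw [Prod.smul_fst, Pi.smul_apply, norm_smul, mul_pow, Real.norm_eq_abs, sq_abs]
      ring
    have e2 : ∑ S : M.sidesIn B.I, area S.1.1 * |(t • x).2 S| =
        |t| * ∑ S : M.sidesIn B.I, area S.1.1 * |x.2 S| := by
      rw [Finset.mul_sum]
      refine Finset.sum_congr rfl fun S _ => ?_
      rw [Prod.smul_snd, Pi.smul_apply, smul_eq_mul, abs_mul]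
      ring
    rw [hQ, hQ, e1, e2, mul_pow, sq_abs]
    ring
  have hQp : ∀ x, x ≠ 0 → 0 < Q x := by
    intro x hx
    have n1 : ∀ T : M.cells, 0 ≤ volume.real (body T.1) * ‖x.1 T‖ ^ 2 := fun T => by positivity
    have n2 : ∀ S : M.sidesIn B.I, 0 ≤ area S.1.1 * |x.2 S| := fun S =>
      mul_nonneg (M.area_pos hd S.1).le (abs_nonneg _)
    have s1 := Finset.sum_nonneg fun T (_ : T ∈ Finset.univ) => n1 T
    have s2 : 0 ≤ 1 / (2 * m) * (∑ S : M.sidesIn B.I, area S.1.1 * |x.2 S|) ^ 2 := by positivity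
    refine lt_of_le_of_ne (by rw [hQ]; linarith) fun h0 => hx ?_
    rw [hQ] at h0
    have z1 : ∑ T : M.cells, volume.real (body T.1) * ‖x.1 T‖ ^ 2 = 0 := by linarith
    have z2 : 1 / (2 * m) * (∑ S : M.sidesIn B.I, area S.1.1 * |x.2 S|) ^ 2 = 0 := by linarith
    have z3 := sq_eq_zero_iff.1 ((mul_eq_zero.1 z2).resolve_left (by positivity))
    rw [Finset.sum_eq_zero_iff_of_nonneg fun T _ => n1 T] at z1
    rw [Finset.sum_eq_zero_iff_of_nonneg fun S _ => n2 S] at z3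
    refine Prod.ext (funext fun T => ?_) (funext fun S => ?_)
    · have := (mul_eq_zero.1 (z1 T (Finset.mem_univ T))).resolve_left
        (volume_body_pos (M.cell_indep T) (M.cell_card T)).ne'
      simpa using this
    · have := (mul_eq_zero.1 (z3 S (Finset.mem_univ S))).resolve_left (M.area_pos hd S.1).ne'
      simpa using this
  -- The quadratic part sees a function only through these data. `Φ` may have a kernel, so
  -- coercivity is available on its target rather than on the function space.
  let Φ : M.BrokenP1 →ₗ[ℝ] (M.cells → Space d) × (M.sidesIn B.I → ℝ) :=
    { toFun := fun v => (grad v, fun S => sideAvg v S.1)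
      map_add' := fun v w => Prod.ext (funext fun T => grad_add v w T)
        (funext fun S => sideAvg_add hd v w S.1)
      map_smul' := fun t v => Prod.ext (funext fun T => grad_smul t v T)
        (funext fun S => sideAvg_smul hd t v S.1) }
  let l : M.BrokenP1 →ₗ[ℝ] ℝ :=
    { toFun := load M B f g
      map_add' := load_add hd B f g
      map_smul' := load_smul hd B f g }
  let W : Submodule ℝ M.BrokenP1 :=
    { carrier := {w | PrimalAdmissible M B (0 : M.sidesIn B.D → ℝ) w}
      add_mem' := fun {a b} ha hb => ⟨add_mem_CR hd ha.1 hb.1, fun S => by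
        rw [sideAvg_add hd, ha.2, hb.2]; simp⟩
      zero_mem' := ⟨(mem_CR_iff hd _).2 fun _ _ _ _ _ => rfl, fun S => by
        rw [sideAvg_eq hd]; rfl⟩
      smul_mem' := fun t a ha => ⟨smul_mem_CR hd t ha.1, fun S => by
        rw [sideAvg_smul hd, ha.2]; simp⟩ }
  have hJ : ∀ w, primalReal M B m f g w = Q (Φ w) - l w := fun w => rfl
  have hadm : ∀ w ∈ W, PrimalAdmissible M B uD (v + w) := fun w hw =>
    ⟨add_mem_CR hd hv.1 hw.1, fun S => by
      have := hw.2 S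
      rw [sideAvg_add hd, hv.2, this]; simp⟩
  obtain ⟨w, hw, hmin⟩ := exists_forall_comp_sub_le hQc hQh hQp Φ l v W c fun w hw => by
    rw [← hJ]
    exact hc _ (hadm w hw)
  refine ⟨v + w, hadm w hw, fun w' hw' => ?_⟩
  have hsub : w' - v ∈ W := by
    have e : w' - v = w' + (-1 : ℝ) • v := by rw [neg_one_smul, sub_eq_add_neg]
    rw [e]
    refine ⟨add_mem_CR hd hw'.1 (smul_mem_CR hd _ hv.1), fun S => ?_⟩
    rw [sideAvg_add hd, sideAvg_smul hd, hw'.2, hv.2]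
    simp
  have h := hmin _ hsub
  rw [← hJ, ← hJ, add_sub_cancel] at h
  exact h

omit hd in
/-- Convexity of the squared weighted `ℓ¹`-norm along segments. -/
theorem sq_sum_abs_add_le {ι : Type*} [Fintype ι] {a : ι → ℝ} (ha : ∀ i, 0 ≤ a i) (x w : ι → ℝ)
    {t : ℝ} (ht : 0 ≤ t) (ht1 : t ≤ 1) :
    (∑ i, a i * |x i + t * w i|) ^ 2 ≤
      (1 - t) * (∑ i, a i * |x i|) ^ 2 + t * (∑ i, a i * |x i + w i|) ^ 2 := by
  have h0 : 0 ≤ ∑ i, a i * |x i + t * w i| :=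
    Finset.sum_nonneg fun i _ => mul_nonneg (ha i) (abs_nonneg _)
  have h1 : ∑ i, a i * |x i + t * w i| ≤
      (1 - t) * ∑ i, a i * |x i| + t * ∑ i, a i * |x i + w i| := by
    rw [Finset.mul_sum, Finset.mul_sum, ← Finset.sum_add_distrib]
    refine Finset.sum_le_sum fun i _ => ?_
    have : |x i + t * w i| ≤ (1 - t) * |x i| + t * |x i + w i| := by
      have e : x i + t * w i = (1 - t) * x i + t * (x i + w i) := by ring
      rw [e]
      refine (abs_add_le _ _).trans ?_
      rw [abs_mul, abs_mul, abs_of_nonneg ht, abs_of_nonneg (sub_nonneg.2 ht1)]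
    calc a i * |x i + t * w i| ≤ a i * ((1 - t) * |x i| + t * |x i + w i|) :=
          mul_le_mul_of_nonneg_left this (ha i)
      _ = _ := by ring
  refine (pow_le_pow_left₀ h0 h1 2).trans ?_
  set A := ∑ i, a i * |x i|
  set C := ∑ i, a i * |x i + w i|
  -- The defect in the convexity of the square is `t (1 - t) (A - C) ^ 2`.
  nlinarith [mul_nonneg (mul_nonneg ht (sub_nonneg.2 ht1)) (sq_nonneg (A - C))]

/-- The variational inequality satisfied by minimisers of the discrete primal energy. -/
theorem variational_inequality {m : ℝ} (hm : 0 < m) {uD : M.sidesIn B.D → ℝ} {u : M.BrokenP1}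
    (hu : PrimalAdmissible M B uD u)
    (hmin : ∀ w, PrimalAdmissible M B uD w → primalReal M B m f g u ≤ primalReal M B m f g w)
    {w : M.BrokenP1} (hw : PrimalAdmissible M B (0 : M.sidesIn B.D → ℝ) w) :
    1 / (2 * m) * insulationNorm M B u ^ 2 + (load M B f g w -
        ∑ T : M.cells, volume.real (body T.1) * inner ℝ (grad u T) (grad w T)) ≤
      1 / (2 * m) * insulationNorm M B (u + w) ^ 2 := by
  rw [← le_sub_iff_add_le']
  -- The minimiser is compared with `u + t • w`. Convexity handles the non-smooth insulation term,
  -- and the quadratic gradient term disappears at first order.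
  refine le_of_forall_mul_le
    (K := 1 / 2 * ∑ T : M.cells, volume.real (body T.1) * ‖grad w T‖ ^ 2) fun t ht ht1 => ?_
  have hadm : PrimalAdmissible M B uD (u + t • w) :=
    ⟨add_mem_CR hd hu.1 (smul_mem_CR hd t hw.1), fun S => by
      rw [sideAvg_add hd, sideAvg_smul hd, hu.2, hw.2]; simp⟩
  have h := hmin _ hadm
  have hconv : insulationNorm M B (u + t • w) ^ 2 ≤
      (1 - t) * insulationNorm M B u ^ 2 + t * insulationNorm M B (u + w) ^ 2 := by
    simp only [insulationNorm, sideAvg_add hd, sideAvg_smul hd]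
    exact sq_sum_abs_add_le (fun S : M.sidesIn B.I => (M.area_pos hd S.1).le) _ _ ht.le ht1
  have hgrad : ∑ T : M.cells, volume.real (body T.1) * ‖grad (u + t • w) T‖ ^ 2 =
      ∑ T : M.cells, volume.real (body T.1) * ‖grad u T‖ ^ 2 +
      2 * t * ∑ T : M.cells, volume.real (body T.1) * inner ℝ (grad u T) (grad w T) +
      t ^ 2 * ∑ T : M.cells, volume.real (body T.1) * ‖grad w T‖ ^ 2 := by
    rw [Finset.mul_sum, Finset.mul_sum, ← Finset.sum_add_distrib, ← Finset.sum_add_distrib]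
    refine Finset.sum_congr rfl fun T _ => ?_
    rw [grad_add, grad_smul, norm_add_sq_real, inner_smul_right, norm_smul, mul_pow,
      Real.norm_eq_abs, sq_abs]
    ring
  rw [primalReal, primalReal, hgrad, load_add hd, load_smul hd] at h
  have hconv' := mul_le_mul_of_nonneg_left hconv (show 0 ≤ 1 / (2 * m) by positivity)
  linarith

end Linear

/-! ### Strong duality by flux reconstruction. -/

section Reconstruction

variable {d : ℕ} {Ω : Set (Space d)} {M : Triangulation Ω}

/-- The vector field reconstructed from a Crouzeix--Raviart function `u` and a load `f`. -/
def reconstruction (f : M.cells → ℝ) (u : M.BrokenP1) : M.BrokenP1Vec := fun T =>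
  AffineMap.const ℝ (Space d) (grad u T) -
    (f T / d) • (AffineMap.id ℝ (Space d) - AffineMap.const ℝ (Space d) (bary T.1))

theorem reconstruction_apply (f : M.cells → ℝ) (u : M.BrokenP1) (T : M.cells) (x : Space d) :
    reconstruction f u T x = grad u T - (f T / d) • (x - bary T.1) := rfl

theorem reconstruction_bary (f : M.cells → ℝ) (u : M.BrokenP1) (T : M.cells) :
    reconstruction f u T (bary T.1) = grad u T := by
  rw [reconstruction_apply, sub_self, smul_zero, sub_zero]

theorem div_reconstruction (hd : 1 ≤ d) (f : M.cells → ℝ) (u : M.BrokenP1) (T : M.cells) :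
    div (reconstruction f u) T = -f T := by
  have hd0 : (d : ℝ) ≠ 0 := by positivity
  have h : (reconstruction f u T).linear = -((f T / d) • LinearMap.id) := by
    ext1 w
    simp [reconstruction]
  rw [div, h, map_neg, map_smul, LinearMap.trace_id, finrank_euclideanSpace_fin, smul_eq_mul,
    div_mul_cancel₀ _ hd0]

/-- Moving within a side changes the field by a multiple of a tangential vector, which is orthogonal
to the normal. -/
theorem hasConstFlux_reconstruction (f : M.cells → ℝ) (u : M.BrokenP1) :
    HasConstFlux (reconstruction f u) := by
  intro T S hS x hx
  have h := (M.isOutwardUnitNormal hS).inner_sub_eq_zero hx (bary_mem_body (M.side_nonempty S))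
  rw [flux, ← sub_eq_zero, ← inner_sub_left, reconstruction_apply, reconstruction_apply,
    real_inner_comm]
  have e : grad u T - (f T / d) • (x - bary T.1) - (grad u T - (f T / d) • (bary S.1 - bary T.1)) =
      -(f T / d) • (x - bary S.1) := by module
  rw [e, inner_smul_right, h, mul_zero]

/-- Strong duality: the vector field reconstructed from a primal solution is dual admissible and
leaves no gap. -/
theorem reconstruction_no_gap (hd : 1 ≤ d) (hΩ : IsOpen Ω) (hreg : interior (closure Ω) = Ω)
    {B : BoundarySplitting Ω} (hMB : M.Resolves B) {m : ℝ} (hm : 0 < m) {f : M.cells → ℝ}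
    {g : M.sidesIn B.N → ℝ} {uD : M.sidesIn B.D → ℝ} {u : M.BrokenP1}
    (hu : PrimalAdmissible M B uD u)
    (hmin : ∀ w, PrimalAdmissible M B uD w → primalReal M B m f g u ≤ primalReal M B m f g w) :
    DualAdmissible M B f g (reconstruction f u) ∧
      primalReal M B m f g u ≤ dualReal M B m uD (reconstruction f u) := by
  classical
  set z := reconstruction f u with hz
  have hzc : HasConstFlux z := hasConstFlux_reconstruction f u
  -- `Z` is the normal jump on interior sides and the outward flux on boundary sides, so one family
  -- of tests covers both.
  set Z : M.sides → ℝ := fun S => ∑ T : M.cells with S.1 ⊆ T.1, flux z T S with hZ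
  -- The variational inequality is tested with `crLift`. Since the divergence is `-f`, integration
  -- by parts absorbs the volume load and leaves only side terms.
  have hvar : ∀ w : M.sides → ℝ, (∀ S ∈ M.sidesIn B.D, w S = 0) →
      1 / (2 * m) * insulationNorm M B u ^ 2 +
        (∑ S : M.sidesIn B.N, area S.1.1 * (g S * w S.1) - ∑ S, area S.1 * (Z S * w S)) ≤
      1 / (2 * m) * (∑ S : M.sidesIn B.I, area S.1.1 * |sideAvg u S.1 + w S.1|) ^ 2 := by
    intro w hw
    have h := variational_inequality hd B f g hm hu hmin (w := crLift hd w)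
      ⟨crLift_mem_CR hd w, fun S => by rw [sideAvg_crLift, hw S.1 S.2]; rfl⟩
    have hibp := sum_volume_mul_eq hd hzc (crLift hd w)
    have hr : ∑ S : M.sides, ∑ T : M.cells with S.1 ⊆ T.1,
        area S.1 * (flux z T S * crLift hd w T (bary S.1)) = ∑ S, area S.1 * (Z S * w S) := by
      refine Finset.sum_congr rfl fun S _ => ?_
      rw [hZ, Finset.sum_mul, Finset.mul_sum]
      refine Finset.sum_congr rfl fun T hT => ?_
      rw [crLift_bary hd w (Finset.mem_filter.1 hT).2]
    rw [hr] at hibp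
    simp only [hz, reconstruction_bary, div_reconstruction hd, mul_add, neg_mul, mul_neg,
      Finset.sum_add_distrib, Finset.sum_neg_distrib] at hibp
    have hcomm : ∑ T : M.cells, volume.real (body T.1) * inner ℝ (grad (crLift hd w) T) (grad u T) =
        ∑ T : M.cells, volume.real (body T.1) * inner ℝ (grad u T) (grad (crLift hd w) T) :=
      Finset.sum_congr rfl fun T _ => by rw [real_inner_comm]
    rw [hcomm] at hibp
    simp only [insulationNorm, sideAvg_add hd, sideAvg_crLift, load] at h ⊢
    linarith
  -- Away from the insulated part the non-smooth term is unchanged by the test. The inequality is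
  -- then linear in `t`, and the values `±1` yield equality.
  have hout : ∀ S₀, S₀ ∉ M.sidesIn B.I → S₀ ∉ M.sidesIn B.D →
      ∀ t : ℝ, ∑ S : M.sidesIn B.N, area S.1.1 * (g S * (Pi.single S₀ t : M.sides → ℝ) S.1) ≤
        area S₀.1 * (Z S₀ * t) := by
    intro S₀ hI hD t
    have h := hvar (Pi.single S₀ t) fun S hS => by
      rw [Pi.single_apply, if_neg fun h : S = S₀ => hD (h ▸ hS)]
    have e1 : ∀ S : M.sidesIn B.I, (Pi.single S₀ t : M.sides → ℝ) S.1 = 0 := fun S => by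
      rw [Pi.single_apply, if_neg fun h : S.1 = S₀ => hI (h ▸ S.2)]
    have e2 : ∑ S, area S.1 * (Z S * (Pi.single S₀ t : M.sides → ℝ) S) =
        area S₀.1 * (Z S₀ * t) := by
      rw [Finset.sum_eq_single S₀]
      · rw [Pi.single_eq_same]
      · intro S _ hS
        rw [Pi.single_eq_of_ne hS, mul_zero, mul_zero]
      · simp
    simp only [e1, add_zero, e2, insulationNorm] at h
    linarith
  have hZint : ∀ S, ¬ M.IsBoundarySide S → Z S = 0 := by
    intro S₀ hS₀
    have hnot : ∀ Γ, S₀ ∉ M.sidesIn Γ := fun Γ h => hS₀ ((mem_sidesIn _ _).1 h).1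
    have e : ∀ t : ℝ, ∀ S : M.sidesIn B.N, (Pi.single S₀ t : M.sides → ℝ) S.1 = 0 := fun t S => by
      rw [Pi.single_apply, if_neg fun h : S.1 = S₀ => hnot B.N (h ▸ S.2)]
    have h1 := hout S₀ (hnot _) (hnot _) 1
    have h2 := hout S₀ (hnot _) (hnot _) (-1)
    simp only [e, mul_zero, Finset.sum_const_zero] at h1 h2
    have h3 : area S₀.1 * Z S₀ = 0 := by linarith
    exact (mul_eq_zero.1 h3).resolve_left (M.area_pos hd S₀).ne'
  have hZb : ∀ S, M.IsBoundarySide S → Z S = flux z (M.cellOf S) S := by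
    intro S hS
    rw [hZ]
    simp only
    rw [filter_eq_singleton hd hΩ hreg hS, Finset.sum_singleton]
  have hbdry : ∀ Γ, ∀ S : M.sidesIn Γ, M.IsBoundarySide S.1 := fun Γ S => ((mem_sidesIn _ _).1 S.2).1
  have hZN : ∀ S : M.sidesIn B.N, Z S.1 = g S := by
    intro S₀
    have hI : S₀.1 ∉ M.sidesIn B.I := fun h =>
      Finset.disjoint_left.1 (disjoint_sidesIn B.disjointIN) h S₀.2
    have hD : S₀.1 ∉ M.sidesIn B.D := fun h =>
      Finset.disjoint_left.1 (disjoint_sidesIn B.disjointDN) h S₀.2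
    have e : ∀ t : ℝ, ∑ S : M.sidesIn B.N,
        area S.1.1 * (g S * (Pi.single S₀.1 t : M.sides → ℝ) S.1) = area S₀.1.1 * (g S₀ * t) := by
      intro t
      rw [Finset.sum_eq_single S₀]
      · rw [Pi.single_eq_same]
      · intro S _ hS
        rw [Pi.single_eq_of_ne (fun h => hS (Subtype.ext h)), mul_zero, mul_zero]
      · simp
    have h1 := hout S₀.1 hI hD 1
    have h2 := hout S₀.1 hI hD (-1)
    rw [e] at h1 h2
    have h3 : area S₀.1.1 * (Z S₀.1 - g S₀) = 0 := by linarith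
    linarith [(mul_eq_zero.1 h3).resolve_left (M.area_pos hd S₀.1).ne']
  have hadm : DualAdmissible M B f g z := by
    refine ⟨(mem_RT_iff z).2 ⟨hzc, fun S T T' hne hT hT' => ?_⟩, div_reconstruction hd f u,
      fun S => by rw [← hZb S.1 (hbdry _ S), hZN]⟩
    have h := hZint S (M.not_isBoundarySide_of_ne hd hΩ hreg hne hT hT')
    rw [hZ] at h
    simp only at h
    rwa [filter_eq_pair hd hne hT hT', Finset.sum_pair hne] at h
  refine ⟨hadm, ?_⟩
  have hgap := primalReal_sub_dualReal (m := m) hd hΩ hreg hMB hu hadm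
  have hzero : ∑ T : M.cells, volume.real (body T.1) * ‖grad u T - z T (bary T.1)‖ ^ 2 = 0 :=
    Finset.sum_eq_zero fun T _ => by rw [hz, reconstruction_bary, sub_self]; simp
  -- The remainder in the gap carries the flux with a plus sign, hence the subgradient is minus the
  -- flux.
  have hfy := fenchel_young_le_of_subgradient (a := fun S : M.sidesIn B.I => area S.1.1)
    (lam := fun S => -flux z (M.cellOf S.1) S.1) (x := fun S => sideAvg u S.1) hm
    (fun S => M.area_pos hd S.1)
    (s := surfaceSupNorm B.I fun S : M.sidesIn B.I => normalTrace z S.1)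
    (by simpa only [abs_neg] using surfaceSupNorm_eq hd hzc B.I)
    (by
      intro x'
      have hI : ∀ (Γ : Set (Space d)), Disjoint B.I Γ → ∀ S ∈ M.sidesIn Γ, S ∉ M.sidesIn B.I :=
        fun Γ h S hS hSI => Finset.disjoint_left.1 (disjoint_sidesIn h) hSI hS
      -- This perturbation moves the insulated averages of `u` to `x'` and vanishes on all other
      -- sides, so `hvar` becomes the subgradient inequality.
      set w : M.sides → ℝ := fun S =>
        if h : S ∈ M.sidesIn B.I then x' ⟨S, h⟩ - sideAvg u S else 0 with hw
      have w0 : ∀ S, S ∉ M.sidesIn B.I → w S = 0 := fun S h => dif_neg h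
      have wI : ∀ S : M.sidesIn B.I, w S.1 = x' S - sideAvg u S.1 := fun S => dif_pos S.2
      have h := hvar w fun S hS => w0 S (hI _ B.disjointID S hS)
      rw [sum_sides_eq hMB fun S hS => by rw [hZint S hS, zero_mul, mul_zero]] at h
      have wN : ∀ S : M.sidesIn B.N, w S.1 = 0 := fun S => w0 _ (hI _ B.disjointIN S.1 S.2)
      have wD : ∀ S : M.sidesIn B.D, w S.1 = 0 := fun S => w0 _ (hI _ B.disjointID S.1 S.2)
      simp only [wI, wN, wD, mul_zero, Finset.sum_const_zero, add_zero, zero_sub,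
        add_sub_cancel, fun S : M.sidesIn B.I => hZb S.1 (hbdry _ S),
        ← Finset.sum_neg_distrib, insulationNorm] at h
      simpa only [neg_mul, mul_neg] using h)
  simp only [neg_mul, mul_neg, Finset.sum_neg_distrib] at hfy
  rw [hzero, insulationNorm] at hgap
  linarith

end Reconstruction

end Insulation

end

/-! ### Assembly of existence, uniqueness and the error identity. -/

theorem theorem6p4 {d : ℕ} (hd : 1 ≤ d) {Ω : Set (Insulation.Space d)}
    (hΩ : IsOpen Ω) (hreg : interior (closure Ω) = Ω)
    (M : Insulation.Triangulation Ω) (B : Insulation.BoundarySplitting Ω) (hMB : M.Resolves B)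
    (m : ℝ) (hm : 0 < m)
    (f : M.cells → ℝ) (g : M.sidesIn B.N → ℝ) (uD : M.sidesIn B.D → ℝ) :
    ∀ v ∈ Insulation.primalSet M B m f g uD, ∀ y ∈ Insulation.dualSet M B m f g uD,
      (∃ u, Insulation.IsPrimalSolution M B m f g uD u) ∧
      (∃! z, Insulation.IsDualSolution M B m f g uD z) ∧
      ∀ u z, Insulation.IsPrimalSolution M B m f g uD u →
        Insulation.IsDualSolution M B m f g uD z →
        Insulation.totalError M B m f g uD u z v y =
          Insulation.gapEstimator M B m f g uD v y := by
  intro v hv y hy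
  rw [Insulation.mem_primalSet_iff] at hv
  rw [Insulation.mem_dualSet_iff hd] at hy
  simp only [Insulation.isPrimalSolution_iff, Insulation.isDualSolution_iff hd]
  have hweak : ∀ {v y}, Insulation.PrimalAdmissible M B uD v →
      Insulation.DualAdmissible M B f g y →
      Insulation.dualReal M B m uD y ≤ Insulation.primalReal M B m f g v := fun hv hy =>
    Insulation.dualReal_le_primalReal hd hΩ hreg hMB hm hv hy
  -- The given `y` supplies the lower bound through weak duality, and `v` supplies an admissible
  -- starting point.
  obtain ⟨u, hu, humin⟩ := Insulation.exists_primalReal_min hd B f g hm hv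
    fun w hw => hweak hw hy
  obtain ⟨hz, hgap⟩ := Insulation.reconstruction_no_gap hd hΩ hreg hMB hm hu humin
  refine ⟨⟨u, hu, humin⟩, ⟨_, ⟨hz, fun y' hy' => (hweak hu hy').trans hgap⟩, ?_⟩, ?_⟩
  · rintro z' ⟨hz', hmax⟩
    -- A maximiser is at least as good as the reconstructed field, so it too leaves no gap to `u`.
    exact Insulation.dual_unique_of_no_gap hd hΩ hreg hMB hm hu hz' hz
      (hgap.trans (hmax _ hz)) hgap
  · rintro u' z' ⟨hu', humin'⟩ ⟨hz', hmax⟩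
    -- Arbitrary solutions inherit the vanishing gap from the constructed pair. All four energies
    -- are finite, so the cancellation takes place in the reals.
    have heq : Insulation.primalReal M B m f g u' = Insulation.dualReal M B m uD z' :=
      le_antisymm ((humin' u hu).trans (hgap.trans (hmax _ hz))) (hweak hu' hz')
    rw [Insulation.totalError, Insulation.gapEstimator, Insulation.primalError,
      Insulation.dualError, Insulation.primalEnergy_of_admissible hv,
      Insulation.primalEnergy_of_admissible hu', Insulation.dualEnergy_of_admissible hd hy,
      Insulation.dualEnergy_of_admissible hd hz', heq]
    norm_cast
    ring
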